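/- Consider the Gaussian design trace regression model $Y_i=\mathrm{tr}(X^i\theta)+\epsilon_i$, $i=1,\dots,n$, where $\theta\in\mathbb M_d$ (the real $d\times d$ matrices), the entries of the $d\times d$ matrices $X^1,\dots,X^n$ and the noise variables $\epsilon_1,\dots,\epsilon_n$ are all independent and $N(0,1)$, and $\mathcal X=(X^1,\dots,X^n)$. Write $\mathbb P_\theta,\mathbb E_\theta$ for the law of $(\mathcal X,Y)$ and its expectation, $R(k)$ for the set of $\theta\in\mathbb M_d$ of rank at most $k$, $\|M\|_*$ for the nuclear norm (sum of the singular values), and $|C|_*=\sup_{a,b\in C}\|a-b\|_*\in[0,\infty]$ for the nuclear-norm diameter of $C\subseteq\mathbb M_d$. A confidence set is a set-valued function $C_n=C_n(Y,\mathcal X)\subseteq\mathbb M_d$ of the data, given for all $n,d$; given models $\Theta=\Theta_{n,d}\subseteq\mathbb M_d$, it is asymptotically honest over $\Theta$ at level $1-\alpha$ if $\liminf_{\min(n,d)\to\infty}\inf_{\theta\in\Theta}\mathbb P_\theta(\theta\in C_n)\ge 1-\alpha$. The ranks $k_0,k_1$ are natural numbers that may depend on $(n,d)$, and all limits and $o(\cdot)$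 are as $\min(n,d)\to\infty$. Let $0<\alpha<1/3$. (i) There is a constant $c>0$ depending only on $\alpha$ such that the following holds. Let $k_1\to\infty$ with $k_1=o(d)$, and let $C_n$ be asymptotically honest over $R(k_1)$ at level $1-\alpha$. Then for every $k_0\ge 1$ with $k_0=o(k_1)$, $$\sup_{\theta\in R(k_0)}\mathbb E_\theta|C_n|_*\ \ge\ c\,\sqrt{\frac{k_1 d}{n}}\qquad\text{for all large enough }\min(n,d).$$ (ii) Consequently, for no $k_0\ge1$ with $k_0=o(\sqrt d)$ does there exist a confidence set that is asymptotically honest over all of $\mathbb M_d$ at level $1-\alpha$ and adapts in nuclear norm to the models $R(k_0)$. Here adaptation means that the diameter attains the minimax estimation rate $k_0\sqrt{d/n}$ over $R(k_0)$, and non-existence holds under either of these two readings: there is a constant $K$ such that, for all large enough $\min(n,d)$, either $\sup_{\theta\in R(k_0)}\mathbb E_\theta|C_n|_*\le K k_0\sqrt{d/n}$ or, respectively, $\sup_{\theta\in R(k_0)}\mathbb P_\theta\big(|C_n|_*>K k_0\sqrt{d/n}\big)\le\alpha$. -/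

import Mathlib

open MeasureTheory ProbabilityTheory Filter Asymptotics
open scoped ENNReal NNReal Topology Matrix

noncomputable section

namespace TraceRegression

/-- The space `𝕄_d` of real `d × d` matrices. -/
abbrev Mat (d : ℕ) : Type := Matrix (Fin d) (Fin d) ℝ

/-- The product (Borel) σ-algebra on `𝕄_d`. -/
instance instMeasurableSpaceMat (d : ℕ) : MeasurableSpace (Mat d) :=
  inferInstanceAs (MeasurableSpace (Fin d → Fin d → ℝ))

/-- The model `R(k)`: the real `d × d` matrices of rank at most `k`. -/
def lowRank (d k : ℕ) : Set (Mat d) := {θ | θ.rank ≤ k}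

/-- The nuclear norm `‖M‖_* = ∑ⱼ |λⱼ|`, where `λⱼ²` are the eigenvalues (with multiplicity) of
`Mᵀ M`; for real matrices the conjugate transpose is the transpose. -/
def nuclearNorm {d : ℕ} (M : Mat d) : ℝ :=
  ∑ j, Real.sqrt ((Matrix.isHermitian_conjTranspose_mul_self M).eigenvalues j)

/-- The nuclear-norm diameter `|S|_*` of a set of matrices, with values in `[0, ∞]`. -/
def nuclearDiam {d : ℕ} (S : Set (Mat d)) : ℝ≥0∞ :=
  ⨆ a ∈ S, ⨆ b ∈ S, ENNReal.ofReal (nuclearNorm (a - b))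

/-- The space of observations `(𝒳, Y)`: the design matrices `X¹, …, Xⁿ` and the responses
`Y₁, …, Yₙ`. -/
abbrev Obs (n d : ℕ) : Type := (Fin n → Mat d) × (Fin n → ℝ)

/-- The law of a random `d × d` matrix with i.i.d. `N(0, 1)` entries. -/
def gaussianMatrix (d : ℕ) : Measure (Mat d) :=
  (Measure.pi fun _ : Fin d => Measure.pi fun _ : Fin d => gaussianReal 0 1 :
    Measure (Fin d → Fin d → ℝ))

/-- The joint law of the design `X¹, …, Xⁿ` (independent Gaussian matrices) and the noise
`ε ~ N(0, Iₙ)`, which are independent of each other. -/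
def designNoise (n d : ℕ) : Measure ((Fin n → Mat d) × (Fin n → ℝ)) :=
  (Measure.pi fun _ : Fin n => gaussianMatrix d).prod
    (Measure.pi fun _ : Fin n => gaussianReal 0 1)

/-- The observation `(𝒳, Y)` with `Yᵢ = tr(Xⁱ θ) + εᵢ`. -/
def observe {n d : ℕ} (θ : Mat d) (ω : (Fin n → Mat d) × (Fin n → ℝ)) : Obs n d :=
  (ω.1, fun i => Matrix.trace (ω.1 i * θ) + ω.2 i)

/-- The law `ℙ_θ` of the observation `(𝒳, Y)` in the Gaussian design trace regression model. -/
def obsLaw (n : ℕ) {d : ℕ} (θ : Mat d) : Measure (Obs n d) :=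
  (designNoise n d).map (observe θ)

/-- A confidence set for every sample size `n` and dimension `d`: a set-valued function
`C_n = C_n(Y, 𝒳) ⊆ 𝕄_d` of the observation whose coverage events `{θ ∈ C_n}` are measurable. -/
structure ConfidenceSet where
  /-- the set computed from the observation -/
  set : (n d : ℕ) → Obs n d → Set (Mat d)
  /-- the coverage events are events -/
  measurableSet_mem : ∀ (n d : ℕ) (θ : Mat d), MeasurableSet {z : Obs n d | θ ∈ set n d z}

namespace ConfidenceSet

/-- The coverage probability `ℙ_θ(θ ∈ C_n)`. -/
def coverage (C : ConfidenceSet) (n : ℕ) {d : ℕ} (θ : Mat d) : ℝ≥0∞ :=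
  obsLaw n θ {z | θ ∈ C.set n d z}

/-- The expected nuclear-norm diameter `𝔼_θ |C_n|_*`. -/
def expectedDiam (C : ConfidenceSet) (n : ℕ) {d : ℕ} (θ : Mat d) : ℝ≥0∞ :=
  ∫⁻ z, nuclearDiam (C.set n d z) ∂(obsLaw n θ)

/-- Asymptotic honesty at level `1 - α` over the models `Θ n d ⊆ 𝕄_d`:
`liminf_{min(n,d) → ∞} inf_{θ ∈ Θ n d} ℙ_θ(θ ∈ C_n) ≥ 1 - α`. -/
def AsymptoticallyHonest (C : ConfidenceSet) (α : ℝ) (Θ : (n d : ℕ) → Set (Mat d)) : Prop :=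
  ENNReal.ofReal (1 - α) ≤
    liminf (fun p : ℕ × ℕ => ⨅ θ ∈ Θ p.1 p.2, C.coverage p.1 θ) atTop

/-- Adaptation in nuclear norm to the models `R(k₀)`, in expectation: the worst-case expected
diameter over `R(k₀)` is at most a constant times the minimax rate `k₀ √(d/n)`. -/
def AdaptsInExpectation (C : ConfidenceSet) (k₀ : ℕ → ℕ → ℕ) : Prop :=
  ∃ K : ℝ, ∀ᶠ p : ℕ × ℕ in atTop,
    (⨆ θ ∈ lowRank p.2 (k₀ p.1 p.2), C.expectedDiam p.1 θ) ≤
      ENNReal.ofReal (K * (k₀ p.1 p.2 * Real.sqrt ((p.2 : ℝ) / p.1)))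

/-- Adaptation in nuclear norm to the models `R(k₀)`, with probability `1 - α`: uniformly over
`R(k₀)`, the diameter exceeds a constant times the minimax rate `k₀ √(d/n)` with probability
at most `α`. -/
def AdaptsInProbability (C : ConfidenceSet) (α : ℝ) (k₀ : ℕ → ℕ → ℕ) : Prop :=
  ∃ K : ℝ, ∀ᶠ p : ℕ × ℕ in atTop, ∀ θ ∈ lowRank p.2 (k₀ p.1 p.2),
    obsLaw p.1 θ {z | ENNReal.ofReal (K * (k₀ p.1 p.2 * Real.sqrt ((p.2 : ℝ) / p.1))) <
      nuclearDiam (C.set p.1 p.2 z)} ≤ ENNReal.ofReal α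

end ConfidenceSet

end TraceRegression

end

/-!
The lower bound compares two mixtures of the laws `ℙ_θ`. The null mixture is uniform over the
rank one matrices `a · u vᵀ` with sign vectors `u, v`; the alternative is uniform over the matrices
`a · D_u H D_v`, where `D_u`, `D_v` are the diagonal matrices of `u`, `v` and `H` is a fixed `±1`
matrix, tiled from a Sylvester–Hadamard matrix, of rank at most `2 ^ m` (`signedTile`).
Here `2 ^ m` is of the order of `k₁`, and `a` is chosen so that all these matrices have the same
squared Frobenius norm `s`, a small multiple of `d / n`.

* Statistical closeness. Both mixtures are compared with the law `refLaw` under which the responses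
  are `N(0, 1 + s)` and independent of the design. This law has the marginal variance of the
  responses that the models have, so that testing the size of `Y` is of no use, for any `n` and `d`.
  The likelihood ratios satisfy `𝔼 L_θ L_θ' = ((1 + s) / (1 + s - ⟨θ, θ'⟩)) ^ n`
  (`integral_lik_mul`). As `H` has entries `±1`, the overlap `⟨θ, θ'⟩` is `a² ⟨u, u'⟩ ⟨v, v'⟩` for
  both mixtures (`frob_signedTile`), and exponential moments of squares of Rademacher sums bound the
  `χ²` distance (`sum_sum_ratio_pow_le`), hence the total variation distance
  (`abs_avg_obsLaw_sub_refLaw_le`).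
* Separation. The tile has operator norm at most `2 √s / √(2 ^ m)`, and duality with the nuclear
  norm gives nuclear distance at least `√s √(2 ^ m) / 4`, of order `√(k₁ d / n)`, between any member of
  the alternative and any member of the null (`nuclearNorm_signedTile_sub_ge`).

A confidence set with coverage `1 - α` over both families contains a member of each of them with
probability about `1 - 2α` under the null mixture, and then its diameter is at least the separation
(`exists_rank_one_large_diam`). The number `1 - 2α` exceeds `α` because `α < 1/3`, which
gives the bound in expectation and excludes the bound in probability. The second part takes
`k₁ = d`, for which `√(k₁ d / n)` dominates `k₀ √(d / n)` when `k₀ = o(√d)`.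
-/

namespace TraceRegression

/-! ### One-dimensional Gaussian integrals -/

lemma lintegral_exp_quadratic_gaussianReal (v : ℝ≥0) (l b : ℝ) (h : 2 * l * v < 1) :
    ∫⁻ x, ENNReal.ofReal (Real.exp (l * x ^ 2 + b * x)) ∂(gaussianReal 0 v) =
      ENNReal.ofReal ((Real.sqrt (1 - 2 * l * v))⁻¹ *
        Real.exp (b ^ 2 * v / (2 * (1 - 2 * l * v)))) := by
  by_cases hv : v = 0
  · subst hv
    simp
  have hv0 : (0 : ℝ) < v := NNReal.coe_pos.2 (pos_iff_ne_zero.2 hv)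
  have hk : 0 < 1 - 2 * l * v := by linarith
  set k : ℝ := 1 - 2 * l * v with hkdef
  -- completing the square turns the integrand into a multiple of a Gaussian density
  let w : ℝ≥0 := ⟨v / k, by positivity⟩
  have hwc : (w : ℝ) = v / k := rfl
  have hw : w ≠ 0 := by
    intro h0
    have : (w : ℝ) = 0 := by rw [h0]; rfl
    rw [hwc] at this
    have : 0 < (v : ℝ) / k := by positivity
    linarith
  rw [gaussianReal_of_var_ne_zero _ hv,
    lintegral_withDensity_eq_lintegral_mul _ (measurable_gaussianPDF _ _) (by fun_prop)]
  have key : ∀ x : ℝ, gaussianPDFReal 0 v x * Real.exp (l * x ^ 2 + b * x) =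
      ((Real.sqrt k)⁻¹ * Real.exp (b ^ 2 * v / (2 * k))) *
        gaussianPDFReal (b * v / k) w x := by
    intro x
    have hs : Real.sqrt (2 * Real.pi * w) = Real.sqrt (2 * Real.pi * v) / Real.sqrt k := by
      rw [hwc, ← Real.sqrt_div (by positivity)]
      congr 1
      ring
    have hl : l = (1 - k) / (2 * v) := by rw [hkdef]; field_simp; ring
    have he : -(x - 0) ^ 2 / (2 * (v : ℝ)) + (l * x ^ 2 + b * x) =
        b ^ 2 * v / (2 * k) + -(x - b * v / k) ^ 2 / (2 * (w : ℝ)) := by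
      rw [hwc, hl]
      field_simp
      ring
    simp only [gaussianPDFReal]
    rw [hs, mul_assoc, ← Real.exp_add, he, Real.exp_add]
    have : 0 < Real.sqrt k := Real.sqrt_pos.2 hk
    have : 0 < Real.sqrt (2 * Real.pi * v) := Real.sqrt_pos.2 (by positivity)
    field_simp
  calc _ = ∫⁻ x, ENNReal.ofReal ((Real.sqrt k)⁻¹ * Real.exp (b ^ 2 * v / (2 * k))) *
        gaussianPDF (b * v / k) w x := by
        refine lintegral_congr fun x => ?_
        simp only [Pi.mul_apply, gaussianPDF]
        rw [← ENNReal.ofReal_mul (gaussianPDFReal_nonneg _ _ _), key,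
          ENNReal.ofReal_mul (by positivity)]
    _ = _ := by
        rw [lintegral_const_mul _ (measurable_gaussianPDF _ _), lintegral_gaussianPDF_eq_one _ hw,
          mul_one]

/-- The density of `N(t, 1)` with respect to `N(0, 1 + s)`. -/
noncomputable def coordLik (s : ℝ≥0) (t y : ℝ) : ℝ :=
  Real.sqrt (1 + s) * Real.exp (-(y - t) ^ 2 / 2 + y ^ 2 / (2 * (1 + s)))

lemma coordLik_nonneg (s : ℝ≥0) (t y : ℝ) : 0 ≤ coordLik s t y := by
  unfold coordLik; positivity

lemma measurable_coordLik {Ω : Type*} [MeasurableSpace Ω] (s : ℝ≥0) {f g : Ω → ℝ}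
    (hf : Measurable f) (hg : Measurable g) : Measurable fun ω => coordLik s (f ω) (g ω) := by
  unfold coordLik; fun_prop

lemma gaussianReal_one_eq_withDensity (s : ℝ≥0) (t : ℝ) :
    gaussianReal t 1 =
      (gaussianReal 0 (1 + s)).withDensity fun y => ENNReal.ofReal (coordLik s t y) := by
  have hm : Measurable fun y => ENNReal.ofReal (coordLik s t y) :=
    (measurable_coordLik s measurable_const measurable_id).ennreal_ofReal
  have hv : (1 + s : ℝ≥0) ≠ 0 := by positivity
  rw [gaussianReal_of_var_ne_zero _ one_ne_zero, gaussianReal_of_var_ne_zero _ hv,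
    ← withDensity_mul _ (measurable_gaussianPDF _ _) hm]
  congr 1
  ext y
  simp only [Pi.mul_apply, gaussianPDF]
  rw [← ENNReal.ofReal_mul (gaussianPDFReal_nonneg _ _ _)]
  congr 1
  have h1 : (0 : ℝ) < 1 + s := by positivity
  simp only [gaussianPDFReal, coordLik, NNReal.coe_add, NNReal.coe_one]
  have : Real.sqrt (2 * Real.pi * (1 + s)) = Real.sqrt (2 * Real.pi * 1) * Real.sqrt (1 + s) := by
    rw [← Real.sqrt_mul (by positivity), mul_one]
  rw [this]
  have e : -(y - t) ^ 2 / (2 * 1) =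
      -(y - 0) ^ 2 / (2 * (1 + (s : ℝ))) + (-(y - t) ^ 2 / 2 + y ^ 2 / (2 * (1 + s))) := by ring
  rw [e, Real.exp_add]
  have : 0 < Real.sqrt (1 + (s : ℝ)) := Real.sqrt_pos.2 h1
  have : 0 < Real.sqrt (2 * Real.pi * 1) := Real.sqrt_pos.2 (by positivity)
  field_simp

/-- The result is a product of a function of `t + t'` and a function of `t - t'`, which become
independent once `t` and `t'` are the linear functionals of the design given by two matrices of the
same Frobenius norm. -/
lemma lintegral_coordLik_mul (s : ℝ≥0) (t t' : ℝ) :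
    ∫⁻ y, ENNReal.ofReal (coordLik s t y * coordLik s t' y) ∂(gaussianReal 0 (1 + s)) =
      ENNReal.ofReal ((1 + s) / Real.sqrt (1 + 2 * s) *
        (Real.exp ((4 * (1 + 2 * (s : ℝ)))⁻¹ * (t + t') ^ 2) *
          Real.exp (-4⁻¹ * (t - t') ^ 2))) := by
  have h1 : (0 : ℝ) < 1 + s := by positivity
  have h2 : (0 : ℝ) < 1 + 2 * s := by positivity
  have e : 1 - 2 * (-1 + (1 + (s : ℝ))⁻¹) * ((1 + s : ℝ≥0) : ℝ) = 1 + 2 * s := by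
    push_cast; field_simp; ring
  have key : ∀ y, ENNReal.ofReal (coordLik s t y * coordLik s t' y) =
      ENNReal.ofReal ((1 + s) * Real.exp (-(t ^ 2 + t' ^ 2) / 2)) *
        ENNReal.ofReal (Real.exp ((-1 + (1 + (s : ℝ))⁻¹) * y ^ 2 + (t + t') * y)) := by
    intro y
    rw [← ENNReal.ofReal_mul (by positivity)]
    congr 1
    unfold coordLik
    rw [mul_mul_mul_comm, Real.mul_self_sqrt h1.le, ← Real.exp_add, mul_assoc, ← Real.exp_add]
    congr 2
    field_simp
    ring
  simp_rw [key]
  rw [lintegral_const_mul _ (by fun_prop), lintegral_exp_quadratic_gaussianReal _ _ _ (by linarith),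
    e, ← ENNReal.ofReal_mul (by positivity)]
  congr 1
  rw [← Real.exp_add, mul_mul_mul_comm, ← Real.exp_add, div_eq_mul_inv]
  congr 2
  push_cast
  field_simp
  ring

/-! ### Linear functionals of a Gaussian matrix -/

lemma lintegral_pi_prod {ι : Type*} [Fintype ι] {E : ι → Type*} [∀ i, MeasurableSpace (E i)]
    (μ : ∀ i, Measure (E i)) [∀ i, IsProbabilityMeasure (μ i)] {f : ∀ i, E i → ℝ≥0∞}
    (hf : ∀ i, Measurable (f i)) :
    ∫⁻ x, ∏ i, f i (x i) ∂(Measure.pi μ) = ∏ i, ∫⁻ x, f i x ∂(μ i) := by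
  refine (lintegral_prod_eq_prod_lintegral_of_indepFun Finset.univ
    (fun i (x : ∀ i, E i) => f i (x i))
    (iIndepFun_pi fun i => (hf i).aemeasurable)
    fun i => (hf i).comp (measurable_pi_apply i)).trans ?_
  refine Finset.prod_congr rfl fun i _ => ?_
  exact (measurePreserving_eval μ i).lintegral_comp (hf i)

lemma pi_withDensity {ι : Type*} [Fintype ι] {E : ι → Type*} [∀ i, MeasurableSpace (E i)]
    (μ ν : ∀ i, Measure (E i)) [∀ i, IsProbabilityMeasure (μ i)] [∀ i, IsProbabilityMeasure (ν i)]
    {f : ∀ i, E i → ℝ≥0∞} (hf : ∀ i, Measurable (f i)) (h : ∀ i, ν i = (μ i).withDensity (f i)) :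
    Measure.pi ν = (Measure.pi μ).withDensity fun x => ∏ i, f i (x i) := by
  refine Measure.pi_eq fun s hs => ?_
  rw [withDensity_apply _ (MeasurableSet.univ_pi hs),
    ← lintegral_indicator (MeasurableSet.univ_pi hs)]
  have : ∀ x, (Set.univ.pi s).indicator (fun x => ∏ i, f i (x i)) x =
      ∏ i, (s i).indicator (f i) (x i) := by
    intro x
    by_cases hx : x ∈ Set.univ.pi s
    · rw [Set.indicator_of_mem hx]
      exact Finset.prod_congr rfl fun i _ => (Set.indicator_of_mem (hx i trivial) _).symm
    · rw [Set.indicator_of_notMem hx]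
      obtain ⟨i, hi⟩ : ∃ i, x i ∉ s i := by simpa using hx
      exact (Finset.prod_eq_zero (Finset.mem_univ i) (Set.indicator_of_notMem hi _)).symm
  simp_rw [this]
  rw [lintegral_pi_prod μ fun i => (hf i).indicator (hs i)]
  refine Finset.prod_congr rfl fun i _ => ?_
  rw [lintegral_indicator (hs i), h i, withDensity_apply _ (hs i)]

/-- The Frobenius inner product `tr(Aᵀ B)`. -/
def frob {m n : Type*} [Fintype m] [Fintype n] (A B : Matrix m n ℝ) : ℝ := ∑ i, ∑ j, A i j * B i j

section GaussianMatrix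

variable {d : ℕ}

instance : IsProbabilityMeasure (gaussianMatrix d) :=
  inferInstanceAs (IsProbabilityMeasure
    (Measure.pi fun _ : Fin d => Measure.pi fun _ : Fin d => gaussianReal 0 1))

lemma measurable_trace_mul (θ : Mat d) : Measurable fun x : Mat d => Matrix.trace (x * θ) := by
  have : Measurable fun x : Fin d → Fin d → ℝ => ∑ i, ∑ j, x i j * θ j i := by fun_prop
  exact this

lemma variance_pi_linear {ι : Type*} [Fintype ι] (a : ι → ℝ) :
    Var[fun x : ι → ℝ => ∑ i, x i * a i; Measure.pi fun _ => gaussianReal 0 1] =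
      ∑ i, a i * a i := by
  have h := variance_sum_pi (μ := fun _ : ι => gaussianReal 0 1) (X := fun i x => x * a i)
    fun i => (memLp_id_gaussianReal 2).mul_const (a i)
  have e : (fun x : ι → ℝ => ∑ i, x i * a i) = ∑ i, fun x : ι → ℝ => x i * a i := by
    ext x; simp
  rw [e, h]
  refine Finset.sum_congr rfl fun i _ => ?_
  rw [variance_mul_const, variance_fun_id_gaussianReal]
  simp [sq]

lemma hasGaussianLaw_pi_pi :
    HasGaussianLaw (fun x : Fin d → Fin d → ℝ => x)
      (Measure.pi fun _ : Fin d => Measure.pi fun _ : Fin d => gaussianReal 0 1) := by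
  have h1 : HasGaussianLaw (fun x : Fin d → ℝ => x)
      (Measure.pi fun _ : Fin d => gaussianReal 0 1) :=
    iIndepFun.hasGaussianLaw (X := fun (i : Fin d) (x : Fin d → ℝ) => x i)
      (fun i => HasLaw.hasGaussianLaw (μ := gaussianReal 0 1)
        ⟨(measurable_pi_apply i).aemeasurable, (measurePreserving_eval _ i).map_eq⟩)
      (iIndepFun_pi (μ := fun _ : Fin d => gaussianReal 0 1) (X := fun _ x => x)
        fun i => aemeasurable_id)
  have : IsGaussian (Measure.pi fun _ : Fin d => gaussianReal 0 1) := by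
    have := h1.isGaussian_map
    rwa [Measure.map_id'] at this
  exact iIndepFun.hasGaussianLaw (X := fun (i : Fin d) (x : Fin d → Fin d → ℝ) => x i)
      (fun i => HasLaw.hasGaussianLaw (μ := Measure.pi fun _ : Fin d => gaussianReal 0 1)
        ⟨(measurable_pi_apply i).aemeasurable, (measurePreserving_eval _ i).map_eq⟩)
      (iIndepFun_pi (μ := fun _ : Fin d => Measure.pi fun _ : Fin d => gaussianReal 0 1)
        (X := fun _ x => x) fun i => aemeasurable_id)

/-- The linear functional `x ↦ tr(x θ)` as a continuous linear map. -/
noncomputable def traceMulCLM (θ : Mat d) : (Fin d → Fin d → ℝ) →L[ℝ] ℝ :=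
  LinearMap.toContinuousLinearMap
    { toFun := fun x => Matrix.trace (Matrix.of x * θ)
      map_add' := fun x y =>
        (congrArg Matrix.trace (Matrix.add_mul (Matrix.of x) (Matrix.of y) θ)).trans
          (Matrix.trace_add _ _)
      map_smul' := fun c x =>
        (congrArg Matrix.trace (Matrix.smul_mul c (Matrix.of x) θ)).trans (Matrix.trace_smul _ _) }

lemma traceMulCLM_apply (θ : Mat d) (x : Mat d) : traceMulCLM θ x = Matrix.trace (x * θ) :=
  rfl

lemma hasGaussianLaw_trace_mul (θ : Mat d) :
    HasGaussianLaw (fun x : Mat d => Matrix.trace (x * θ)) (gaussianMatrix d) := by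
  have h := hasGaussianLaw_pi_pi.map_fun (traceMulCLM θ)
  have e : (fun x => traceMulCLM θ x) = fun x : Mat d => Matrix.trace (x * θ) :=
    funext (traceMulCLM_apply θ)
  rw [e] at h
  exact h

lemma hasGaussianLaw_trace_mul_prod (θ θ' : Mat d) :
    HasGaussianLaw (fun x : Mat d => (Matrix.trace (x * θ), Matrix.trace (x * θ')))
      (gaussianMatrix d) := by
  have h := hasGaussianLaw_pi_pi.map_fun ((traceMulCLM θ).prod (traceMulCLM θ'))
  have e : (fun x => (traceMulCLM θ).prod (traceMulCLM θ') x) =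
      fun x : Mat d => (Matrix.trace (x * θ), Matrix.trace (x * θ')) :=
    funext fun x => Prod.ext (traceMulCLM_apply θ x) (traceMulCLM_apply θ' x)
  rw [e] at h
  exact h

lemma memLp_trace_mul (θ : Mat d) :
    MemLp (fun x : Mat d => Matrix.trace (x * θ)) 2 (gaussianMatrix d) :=
  (hasGaussianLaw_trace_mul θ).memLp_two

lemma variance_trace_mul (θ : Mat d) :
    Var[fun x : Mat d => Matrix.trace (x * θ); gaussianMatrix d] = frob θ θ := by
  have h := variance_sum_pi (μ := fun _ : Fin d => Measure.pi fun _ : Fin d => gaussianReal 0 1)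
    (X := fun i x => ∑ j, x j * θ j i) fun i => by
      refine memLp_finsetSum _ fun j _ => MemLp.mul_const ?_ _
      exact (memLp_id_gaussianReal 2).comp_measurePreserving
        (measurePreserving_eval (fun _ : Fin d => gaussianReal 0 1) j)
  have e : (fun x : Fin d → Fin d → ℝ => ∑ i, ∑ j, x i j * θ j i) =
      ∑ i, fun x : Fin d → Fin d → ℝ => ∑ j, x i j * θ j i := by
    ext x; simp
  rw [← e] at h
  refine h.trans ?_
  simp_rw [variance_pi_linear, frob]
  rw [Finset.sum_comm]

lemma integral_trace_mul (θ : Mat d) :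
    ∫ x, Matrix.trace (x * θ) ∂(gaussianMatrix d) = 0 := by
  have h : ∫ x : Fin d → Fin d → ℝ, ∑ i, ∑ j, x i j * θ j i
      ∂(Measure.pi fun _ : Fin d => Measure.pi fun _ : Fin d => gaussianReal 0 1) = 0 := by
    have mp : ∀ i j, MeasurePreserving (fun x : Fin d → Fin d → ℝ => x i j)
        (Measure.pi fun _ : Fin d => Measure.pi fun _ : Fin d => gaussianReal 0 1)
        (gaussianReal 0 1) := fun i j =>
      (measurePreserving_eval (fun _ : Fin d => gaussianReal 0 1) j).comp
        (measurePreserving_eval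
          (fun _ : Fin d => Measure.pi fun _ : Fin d => gaussianReal 0 1) i)
    have hi : ∀ i j, Integrable (fun x : Fin d → Fin d → ℝ => x i j)
        (Measure.pi fun _ : Fin d => Measure.pi fun _ : Fin d => gaussianReal 0 1) := fun i j =>
      (mp i j).integrable_comp_of_integrable
        (memLp_one_iff_integrable.1 (memLp_id_gaussianReal 1))
    rw [integral_finsetSum _ fun i _ => integrable_finsetSum _ fun j _ => (hi i j).mul_const _]
    refine Finset.sum_eq_zero fun i _ => ?_
    rw [integral_finsetSum _ fun j _ => (hi i j).mul_const _]
    refine Finset.sum_eq_zero fun j _ => ?_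
    have : ∫ x : Fin d → Fin d → ℝ, x i j
        ∂(Measure.pi fun _ : Fin d => Measure.pi fun _ : Fin d => gaussianReal 0 1) = 0 := by
      rw [← integral_map (f := fun y : ℝ => y) (mp i j).measurable.aemeasurable (by fun_prop),
        (mp i j).map_eq, integral_id_gaussianReal]
    rw [integral_mul_const, this, zero_mul]
  exact h

lemma map_trace_mul (θ : Mat d) :
    (gaussianMatrix d).map (fun x => Matrix.trace (x * θ)) =
      gaussianReal 0 (frob θ θ).toNNReal := by
  rw [(hasGaussianLaw_trace_mul θ).map_eq_gaussianReal, integral_trace_mul, variance_trace_mul]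

lemma frob_self_nonneg {m n : Type*} [Fintype m] [Fintype n] (A : Matrix m n ℝ) : 0 ≤ frob A A :=
  Finset.sum_nonneg fun _ _ => Finset.sum_nonneg fun _ _ => mul_self_nonneg _

lemma frob_add_add {m n : Type*} [Fintype m] [Fintype n] (A B : Matrix m n ℝ) :
    frob (A + B) (A + B) = frob A A + 2 * frob A B + frob B B := by
  simp only [frob, Matrix.add_apply, Finset.mul_sum, ← Finset.sum_add_distrib]
  exact Finset.sum_congr rfl fun _ _ => Finset.sum_congr rfl fun _ _ => by ring

lemma frob_sub_sub {m n : Type*} [Fintype m] [Fintype n] (A B : Matrix m n ℝ) :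
    frob (A - B) (A - B) = frob A A - 2 * frob A B + frob B B := by
  simp only [frob, Matrix.sub_apply, Finset.mul_sum, ← Finset.sum_add_distrib,
    ← Finset.sum_sub_distrib]
  exact Finset.sum_congr rfl fun _ _ => Finset.sum_congr rfl fun _ _ => by ring

/-- If `θ` and `θ'` have the same Frobenius norm, then `tr(X (θ + θ'))` and `tr(X (θ - θ'))` are
uncorrelated, hence independent because they are jointly Gaussian. -/
lemma indepFun_trace_mul_add_sub {θ θ' : Mat d} (h : frob θ θ = frob θ' θ') :
    IndepFun (fun x : Mat d => Matrix.trace (x * (θ + θ')))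
      (fun x : Mat d => Matrix.trace (x * (θ - θ'))) (gaussianMatrix d) := by
  refine (hasGaussianLaw_trace_mul_prod _ _).indepFun_of_covariance_eq_zero ?_
  have hv := variance_add (memLp_trace_mul (θ + θ')) (memLp_trace_mul (θ - θ'))
  have e : (fun x : Mat d => Matrix.trace (x * (θ + θ'))) +
      (fun x : Mat d => Matrix.trace (x * (θ - θ'))) =
        fun x : Mat d => Matrix.trace (x * (θ + θ)) := by
    ext x
    simp only [Pi.add_apply, mul_add, mul_sub, Matrix.trace_add, Matrix.trace_sub]
    ring
  rw [e, variance_trace_mul, variance_trace_mul, variance_trace_mul, frob_add_add, frob_add_add,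
    frob_sub_sub] at hv
  linarith

lemma lintegral_gaussianMatrix_exp_sq (θ : Mat d) (l : ℝ) (h : 2 * l * frob θ θ < 1) :
    ∫⁻ x, ENNReal.ofReal (Real.exp (l * Matrix.trace (x * θ) ^ 2)) ∂(gaussianMatrix d) =
      ENNReal.ofReal (Real.sqrt (1 - 2 * l * frob θ θ))⁻¹ := by
  have := lintegral_map (μ := gaussianMatrix d)
    (f := fun t : ℝ => ENNReal.ofReal (Real.exp (l * t ^ 2))) (by fun_prop) (measurable_trace_mul θ)
  rw [← this, map_trace_mul]
  have h' := lintegral_exp_quadratic_gaussianReal (frob θ θ).toNNReal l 0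
    (by rwa [Real.coe_toNNReal _ (frob_self_nonneg θ)])
  simpa [Real.coe_toNNReal _ (frob_self_nonneg θ)] using h'

/-- The second moment of the likelihood ratios for a single observation. -/
lemma lintegral_lintegral_coordLik_mul {s : ℝ≥0} {θ θ' : Mat d} (h : frob θ θ = s)
    (h' : frob θ' θ' = s) :
    ∫⁻ x, ∫⁻ y, ENNReal.ofReal (coordLik s (Matrix.trace (x * θ)) y *
        coordLik s (Matrix.trace (x * θ')) y) ∂(gaussianReal 0 (1 + s)) ∂(gaussianMatrix d) =
      ENNReal.ofReal ((1 + s) / (1 + s - frob θ θ')) := by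
  set r := frob θ θ' with hr
  have hp : frob (θ + θ') (θ + θ') = 2 * (s + r) := by rw [frob_add_add, h, h']; ring
  have hq : frob (θ - θ') (θ - θ') = 2 * (s - r) := by rw [frob_sub_sub, h, h']; ring
  have hrs : r ≤ s := by
    have := frob_self_nonneg (θ - θ')
    rw [hq] at this
    linarith
  have hs0 : (0 : ℝ) ≤ s := s.coe_nonneg
  have hb : 0 < 1 + s - r := by linarith
  have h2 : (0 : ℝ) < 1 + 2 * s := by positivity
  have e1 : 1 - 2 * (4 * (1 + 2 * (s : ℝ)))⁻¹ * (2 * (s + r)) = (1 + s - r) / (1 + 2 * s) := by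
    field_simp; ring
  have e2 : 1 - 2 * (-4⁻¹) * (2 * ((s : ℝ) - r)) = 1 + s - r := by ring
  have hl1 : 2 * (4 * (1 + 2 * (s : ℝ)))⁻¹ * frob (θ + θ') (θ + θ') < 1 := by
    have : 0 < (1 + s - r) / (1 + 2 * (s : ℝ)) := by positivity
    rw [hp]; linarith
  have hl2 : 2 * (-4⁻¹) * frob (θ - θ') (θ - θ') < 1 := by rw [hq]; linarith
  have key : ∀ x : Mat d, ∫⁻ y, ENNReal.ofReal (coordLik s (Matrix.trace (x * θ)) y *
        coordLik s (Matrix.trace (x * θ')) y) ∂(gaussianReal 0 (1 + s)) =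
      ENNReal.ofReal ((1 + s) / Real.sqrt (1 + 2 * s)) *
        (ENNReal.ofReal (Real.exp ((4 * (1 + 2 * (s : ℝ)))⁻¹ * Matrix.trace (x * (θ + θ')) ^ 2)) *
          ENNReal.ofReal (Real.exp (-4⁻¹ * Matrix.trace (x * (θ - θ')) ^ 2))) := by
    intro x
    rw [lintegral_coordLik_mul, ENNReal.ofReal_mul (by positivity),
      ENNReal.ofReal_mul (by positivity), Matrix.mul_add, Matrix.mul_sub, Matrix.trace_add,
      ← Matrix.trace_sub]
  have m0 : ∀ l : ℝ, Measurable fun t : ℝ => ENNReal.ofReal (Real.exp (l * t ^ 2)) :=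
    fun l => by fun_prop
  have m1 : ∀ (l : ℝ) (A : Mat d),
      Measurable fun x : Mat d => ENNReal.ofReal (Real.exp (l * Matrix.trace (x * A) ^ 2)) :=
    fun l A => (m0 l).comp (measurable_trace_mul A)
  simp_rw [key]
  have hc := lintegral_const_mul (μ := gaussianMatrix d)
    (ENNReal.ofReal ((1 + s) / Real.sqrt (1 + 2 * s)))
    ((m1 (4 * (1 + 2 * (s : ℝ)))⁻¹ (θ + θ')).mul (m1 (-4⁻¹) (θ - θ')))
  simp only [Pi.mul_apply] at hc
  rw [hc, lintegral_mul_eq_lintegral_mul_lintegral_of_indepFun''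
      (m1 _ _).aemeasurable (m1 _ _).aemeasurable
      ((indepFun_trace_mul_add_sub (h.trans h'.symm)).comp (m0 _) (m0 _)),
    lintegral_gaussianMatrix_exp_sq _ _ hl1, lintegral_gaussianMatrix_exp_sq _ _ hl2, hp, hq, e1,
    e2, ← ENNReal.ofReal_mul (by positivity), ← ENNReal.ofReal_mul (by positivity),
    Real.sqrt_div hb.le]
  congr 1
  have h3 := Real.mul_self_sqrt hb.le
  have : 0 < Real.sqrt (1 + s - r) := Real.sqrt_pos.2 hb
  have : 0 < Real.sqrt (1 + 2 * (s : ℝ)) := Real.sqrt_pos.2 h2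
  field_simp
  rw [sq, h3]

end GaussianMatrix

/-! ### Likelihood ratios and mixtures -/

section Likelihood

variable {n d : ℕ}

/-- The reference law: a Gaussian design, and responses that are independent of it and
`N(0, 1 + s)`. It has the same marginals as `ℙ_θ` when `‖θ‖_F² = s`. -/
noncomputable def refLaw (n d : ℕ) (s : ℝ≥0) : Measure (Obs n d) :=
  (Measure.pi fun _ : Fin n => gaussianMatrix d).prod
    (Measure.pi fun _ : Fin n => gaussianReal 0 (1 + s))

instance (s : ℝ≥0) : IsProbabilityMeasure (refLaw n d s) := by
  unfold refLaw; infer_instance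

lemma measurable_observe (θ : Mat d) : Measurable (observe (n := n) θ) := by
  refine measurable_fst.prodMk (measurable_pi_lambda _ fun i => ?_)
  exact ((measurable_trace_mul θ).comp ((measurable_pi_apply i).comp measurable_fst)).add
    ((measurable_pi_apply i).comp measurable_snd)

instance (θ : Mat d) : IsProbabilityMeasure (obsLaw n θ) := by
  have : IsProbabilityMeasure (designNoise n d) := by unfold designNoise; infer_instance
  exact Measure.isProbabilityMeasure_map (measurable_observe θ).aemeasurable

/-- The density of `ℙ_θ` with respect to `refLaw n d s`. -/
noncomputable def lik (s : ℝ≥0) (θ : Mat d) (z : Obs n d) : ℝ :=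
  ∏ i, coordLik s (Matrix.trace (z.1 i * θ)) (z.2 i)

lemma lik_nonneg (s : ℝ≥0) (θ : Mat d) (z : Obs n d) : 0 ≤ lik s θ z :=
  Finset.prod_nonneg fun _ _ => coordLik_nonneg _ _ _

lemma measurable_lik (s : ℝ≥0) (θ : Mat d) : Measurable (lik (n := n) s θ) := by
  unfold lik
  refine Finset.measurable_fun_prod _ fun i _ => measurable_coordLik s ?_ ?_
  · exact (measurable_trace_mul θ).comp ((measurable_pi_apply i).comp measurable_fst)
  · exact (measurable_pi_apply i).comp measurable_snd

lemma obsLaw_eq_withDensity (s : ℝ≥0) (θ : Mat d) :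
    obsLaw n θ = (refLaw n d s).withDensity fun z => ENNReal.ofReal (lik s θ z) := by
  ext A hA
  have hO := measurable_observe (n := n) θ
  rw [obsLaw, Measure.map_apply hO hA, designNoise, Measure.prod_apply (hO hA),
    withDensity_apply _ hA, ← lintegral_indicator hA, refLaw,
    lintegral_prod _ (((measurable_lik s θ).ennreal_ofReal.indicator hA).aemeasurable)]
  refine lintegral_congr fun x => ?_
  have hAx : MeasurableSet (Prod.mk x ⁻¹' A : Set (Fin n → ℝ)) := measurable_prodMk_left hA
  have hm : (Measure.pi fun _ : Fin n => gaussianReal 0 1).map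
      (fun e i => Matrix.trace (x i * θ) + e i) =
        Measure.pi fun i : Fin n => gaussianReal (Matrix.trace (x i * θ)) 1 := by
    have := Measure.pi_map_pi (μ := fun _ : Fin n => gaussianReal 0 1)
      (f := fun i e => Matrix.trace (x i * θ) + e)
      (fun i => (measurable_const_add _).aemeasurable)
    rw [this]
    simp_rw [gaussianReal_map_const_add, zero_add]
  have hpre : (Prod.mk x ⁻¹' (observe θ ⁻¹' A) : Set (Fin n → ℝ)) =
      (fun e i => Matrix.trace (x i * θ) + e i) ⁻¹' (Prod.mk x ⁻¹' A) := rfl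
  have hc : ∀ i : Fin n, Measurable fun y =>
      ENNReal.ofReal (coordLik s (Matrix.trace (x i * θ)) y) := fun i =>
    (measurable_coordLik s measurable_const measurable_id).ennreal_ofReal
  rw [hpre, ← Measure.map_apply (by fun_prop) hAx, hm,
    pi_withDensity (fun _ => gaussianReal 0 (1 + s)) _ hc
      fun i => gaussianReal_one_eq_withDensity s _,
    withDensity_apply _ hAx, ← lintegral_indicator hAx]
  refine lintegral_congr fun y => ?_
  by_cases hy : (x, y) ∈ A
  · rw [Set.indicator_of_mem (by exact hy), Set.indicator_of_mem hy, lik,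
      ENNReal.ofReal_prod_of_nonneg fun _ _ => coordLik_nonneg _ _ _]
  · rw [Set.indicator_of_notMem (by exact hy), Set.indicator_of_notMem hy]

lemma lintegral_lik_mul {s : ℝ≥0} {θ θ' : Mat d} (h : frob θ θ = s) (h' : frob θ' θ' = s) :
    ∫⁻ z, ENNReal.ofReal (lik s θ z * lik s θ' z) ∂(refLaw n d s) =
      ENNReal.ofReal ((1 + s) / (1 + s - frob θ θ')) ^ n := by
  have hm : ∀ θ θ' : Mat d, Measurable fun p : Mat d × ℝ =>
      ENNReal.ofReal (coordLik s (Matrix.trace (p.1 * θ)) p.2 *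
        coordLik s (Matrix.trace (p.1 * θ')) p.2) := fun θ θ' => by
    refine (Measurable.mul ?_ ?_).ennreal_ofReal <;>
    exact measurable_coordLik s ((measurable_trace_mul _).comp measurable_fst) measurable_snd
  have hl : Measurable fun z : Obs n d => ENNReal.ofReal (lik s θ z * lik s θ' z) :=
    ((measurable_lik s θ).mul (measurable_lik s θ')).ennreal_ofReal
  rw [refLaw, lintegral_prod _ hl.aemeasurable]
  have key : ∀ x : Fin n → Mat d, ∫⁻ y, ENNReal.ofReal (lik s θ (x, y) * lik s θ' (x, y))
      ∂(Measure.pi fun _ : Fin n => gaussianReal 0 (1 + s)) =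
      ∏ i, ∫⁻ y, ENNReal.ofReal (coordLik s (Matrix.trace (x i * θ)) y *
        coordLik s (Matrix.trace (x i * θ')) y) ∂(gaussianReal 0 (1 + s)) := by
    intro x
    have hy : ∀ i, Measurable fun y : ℝ => ENNReal.ofReal
        (coordLik s (Matrix.trace (x i * θ)) y * coordLik s (Matrix.trace (x i * θ')) y) :=
      fun i => ((measurable_coordLik s measurable_const measurable_id).mul
        (measurable_coordLik s measurable_const measurable_id)).ennreal_ofReal
    rw [← lintegral_pi_prod (fun _ : Fin n => gaussianReal 0 (1 + s)) hy]
    refine lintegral_congr fun y => ?_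
    rw [lik, lik, ← Finset.prod_mul_distrib, ENNReal.ofReal_prod_of_nonneg fun _ _ =>
      mul_nonneg (coordLik_nonneg _ _ _) (coordLik_nonneg _ _ _)]
  simp_rw [key]
  have hx : Measurable fun x : Mat d => ∫⁻ y, ENNReal.ofReal (coordLik s (Matrix.trace (x * θ)) y *
        coordLik s (Matrix.trace (x * θ')) y) ∂(gaussianReal 0 (1 + s)) :=
    (hm θ θ').lintegral_prod_right'
  rw [lintegral_pi_prod (fun _ : Fin n => gaussianMatrix d) fun _ => hx,
    lintegral_lintegral_coordLik_mul h h']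
  simp

lemma integrable_lik_mul {s : ℝ≥0} {θ θ' : Mat d} (h : frob θ θ = s) (h' : frob θ' θ' = s) :
    Integrable (fun z => lik s θ z * lik s θ' z) (refLaw n d s) := by
  refine ⟨((measurable_lik s θ).mul (measurable_lik s θ')).aestronglyMeasurable, ?_⟩
  rw [hasFiniteIntegral_iff_ofReal
    (ae_of_all _ fun z => mul_nonneg (lik_nonneg _ _ _) (lik_nonneg _ _ _)), lintegral_lik_mul h h']
  finiteness

lemma integral_lik_mul {s : ℝ≥0} {θ θ' : Mat d} (h : frob θ θ = s) (h' : frob θ' θ' = s) :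
    ∫ z, lik s θ z * lik s θ' z ∂(refLaw n d s) = ((1 + s) / (1 + s - frob θ θ')) ^ n := by
  have hr := frob_self_nonneg (θ - θ')
  rw [frob_sub_sub, h, h'] at hr
  have hpos : 0 ≤ (1 + s) / (1 + s - frob θ θ') := div_nonneg (by positivity) (by linarith)
  rw [integral_eq_lintegral_of_nonneg_ae
    (ae_of_all _ fun z => mul_nonneg (lik_nonneg _ _ _) (lik_nonneg _ _ _))
    ((measurable_lik s θ).mul (measurable_lik s θ')).aestronglyMeasurable, lintegral_lik_mul h h',
    ENNReal.toReal_pow, ENNReal.toReal_ofReal hpos]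

lemma integrable_lik (s : ℝ≥0) (θ : Mat d) : Integrable (lik s θ) (refLaw n d s) := by
  refine ⟨(measurable_lik s θ).aestronglyMeasurable, ?_⟩
  rw [hasFiniteIntegral_iff_ofReal (ae_of_all _ fun z => lik_nonneg _ _ _),
    ← setLIntegral_univ, ← withDensity_apply _ MeasurableSet.univ, ← obsLaw_eq_withDensity]
  exact measure_lt_top _ _

lemma setIntegral_lik (s : ℝ≥0) (θ : Mat d) {A : Set (Obs n d)} (hA : MeasurableSet A) :
    ∫ z in A, lik s θ z ∂(refLaw n d s) = (obsLaw n θ).real A := by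
  rw [integral_eq_lintegral_of_nonneg_ae (ae_of_all _ fun z => lik_nonneg _ _ _)
    (measurable_lik s θ).aestronglyMeasurable, ← withDensity_apply _ hA, ← obsLaw_eq_withDensity]
  rfl

/-- A mixture of the laws `ℙ_θ` whose averaged second moment of likelihood ratios is at most
`1 + δ²` differs from the reference law by at most `δ` on every event. This is the bound of the
total variation distance by the `χ²` distance. -/
lemma abs_avg_obsLaw_sub_refLaw_le {ι : Type*} [Fintype ι] [Nonempty ι] {s : ℝ≥0}
    {θ : ι → Mat d} (hθ : ∀ i, frob (θ i) (θ i) = s) {δ : ℝ} (hδ : 0 < δ)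
    (hχ : ∑ i, ∑ j, ((1 + s) / (1 + s - frob (θ i) (θ j))) ^ n ≤
      (1 + δ ^ 2) * (Fintype.card ι : ℝ) ^ 2)
    {A : Set (Obs n d)} (hA : MeasurableSet A) :
    |(∑ i, (obsLaw n (θ i)).real A) / Fintype.card ι - (refLaw n d s).real A| ≤ δ := by
  set Q := refLaw n d s with hQ
  have hN : (0 : ℝ) < Fintype.card ι := by exact_mod_cast Fintype.card_pos
  obtain ⟨N, hNdef⟩ : ∃ N : ℝ, N = Fintype.card ι := ⟨_, rfl⟩
  rw [← hNdef] at hN hχ ⊢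
  let f : Obs n d → ℝ := fun z => (∑ i, lik s (θ i) z) / N
  have hf : Integrable f Q := (integrable_finsetSum _ fun i _ => integrable_lik s (θ i)).div_const N
  have hff : ∀ z, f z ^ 2 = (∑ i, ∑ j, lik s (θ i) z * lik s (θ j) z) / N ^ 2 := fun z => by
    simp only [f]
    rw [div_pow, sq, Finset.sum_mul_sum]
  have hf2 : Integrable (fun z => f z ^ 2) Q := by
    simp_rw [hff]
    exact (integrable_finsetSum _ fun i _ => integrable_finsetSum _ fun j _ =>
      integrable_lik_mul (hθ i) (hθ j)).div_const _
  have hI2 : ∫ z, f z ^ 2 ∂Q ≤ 1 + δ ^ 2 := by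
    simp_rw [hff]
    rw [integral_div, integral_finsetSum _ fun i _ => integrable_finsetSum _ fun j _ =>
      integrable_lik_mul (hθ i) (hθ j), div_le_iff₀ (by positivity)]
    refine le_trans (le_of_eq ?_) hχ
    refine Finset.sum_congr rfl fun i _ => ?_
    rw [integral_finsetSum _ fun j _ => integrable_lik_mul (hθ i) (hθ j)]
    exact Finset.sum_congr rfl fun j _ => integral_lik_mul (hθ i) (hθ j)
  have hset : ∀ B : Set (Obs n d), MeasurableSet B →
      ∫ z in B, f z ∂Q = (∑ i, (obsLaw n (θ i)).real B) / N := fun B hB => by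
    simp only [f]
    rw [integral_div, integral_finsetSum _ fun i _ => (integrable_lik s (θ i)).integrableOn]
    exact congrArg (· / N) (Finset.sum_congr rfl fun i _ => setIntegral_lik s (θ i) hB)
  have hI1 : ∫ z, f z ∂Q = 1 := by
    rw [← setIntegral_univ, hset _ MeasurableSet.univ]
    simp [hNdef]
  have h1 : (∑ i, (obsLaw n (θ i)).real A) / N - Q.real A = ∫ z in A, (f z - 1) ∂Q := by
    rw [integral_sub hf.integrableOn (integrable_const _), hset _ hA]
    simp
  have hfa : Integrable (fun z => |f z - 1|) Q := (hf.sub (integrable_const 1)).abs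
  have hsq' : Integrable (fun z => f z ^ 2 - 2 * f z) Q := hf2.sub (hf.const_mul 2)
  have hsq : Integrable (fun z => (f z ^ 2 - 2 * f z + 1)) Q :=
    hsq'.add (integrable_const 1)
  rw [h1]
  calc |∫ z in A, (f z - 1) ∂Q| ≤ ∫ z in A, |f z - 1| ∂Q := abs_integral_le_integral_abs
    _ ≤ ∫ z, |f z - 1| ∂Q :=
        setIntegral_le_integral hfa (ae_of_all _ fun z => abs_nonneg _)
    _ ≤ ∫ z, ((2 * δ)⁻¹ * (f z ^ 2 - 2 * f z + 1) + δ / 2) ∂Q := by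
        refine integral_mono hfa ((hsq.const_mul _).add (integrable_const _)) fun z => ?_
        -- `|x| ≤ x² / (2δ) + δ / 2`, the case of equality being `|x| = δ`
        have h0 : 0 ≤ (2 * δ)⁻¹ * (|f z - 1| - δ) ^ 2 := by positivity
        have h2 : (|f z - 1| - δ) ^ 2 = (f z ^ 2 - 2 * f z + 1) - 2 * δ * |f z - 1| + δ ^ 2 := by
          rw [sub_sq, sq_abs]; ring
        have h3 : (2 * δ)⁻¹ * (|f z - 1| - δ) ^ 2 =
            (2 * δ)⁻¹ * (f z ^ 2 - 2 * f z + 1) - |f z - 1| + δ / 2 := by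
          rw [h2]; field_simp
        rw [h3] at h0
        linarith
    _ = (2 * δ)⁻¹ * (∫ z, f z ^ 2 ∂Q - 1) + δ / 2 := by
        rw [integral_add (hsq.const_mul _) (integrable_const _), integral_const_mul,
          integral_add hsq' (integrable_const _),
          integral_sub hf2 (hf.const_mul 2), integral_const_mul, hI1]
        simp only [integral_const, probReal_univ, one_smul]
        ring
    _ ≤ (2 * δ)⁻¹ * δ ^ 2 + δ / 2 := by gcongr; linarith
    _ = δ := by field_simp; ring

end Likelihood

/-! ### Exponential moments of Rademacher sums -/

section Signs

/-- The sign `±1` encoded by a Boolean. -/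
def sgn (b : Bool) : ℝ := if b then 1 else -1

lemma sgn_mul_self (b : Bool) : sgn b * sgn b = 1 := by cases b <;> simp [sgn]

variable {ι : Type*} [Fintype ι]

lemma sum_exp_sgn_le [DecidableEq ι] (e : ι → ℝ) (he : ∀ i, e i * e i = 1) (b : ℝ) :
    ∑ u : ι → Bool, Real.exp (b * ∑ i, sgn (u i) * e i) ≤
      2 ^ Fintype.card ι * Real.exp (Fintype.card ι * b ^ 2 / 2) := by
  have h : ∀ u : ι → Bool, Real.exp (b * ∑ i, sgn (u i) * e i) =
      ∏ i, Real.exp (b * (sgn (u i) * e i)) := fun u => by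
    rw [Finset.mul_sum, Real.exp_sum]
  simp_rw [h]
  have h2 := Finset.prod_univ_sum (fun _ : ι => (Finset.univ : Finset Bool))
    fun i c => Real.exp (b * (sgn c * e i))
  rw [Fintype.piFinset_univ] at h2
  rw [← h2]
  have h3 : ∀ i, ∑ c : Bool, Real.exp (b * (sgn c * e i)) ≤ 2 * Real.exp (b ^ 2 / 2) := by
    intro i
    have h4 := Real.cosh_le_exp_half_sq (b * e i)
    rw [Real.cosh_eq] at h4
    have h5 : (b * e i) ^ 2 = b ^ 2 := by rw [mul_pow, sq (e i), he, mul_one]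
    rw [h5] at h4
    simp only [Fintype.sum_bool, sgn]
    simp only [if_true, one_mul, Bool.false_eq_true, if_false, neg_mul, mul_neg]
    linarith
  calc ∏ i, ∑ c : Bool, Real.exp (b * (sgn c * e i)) ≤ ∏ _i : ι, 2 * Real.exp (b ^ 2 / 2) :=
        Finset.prod_le_prod (fun i _ => Finset.sum_nonneg fun _ _ => (Real.exp_pos _).le)
          fun i _ => h3 i
    _ = _ := by
        rw [Finset.prod_const, Finset.card_univ, mul_pow, ← Real.exp_nat_mul]
        congr 2
        ring

/-- Exponential moments of the square of a Rademacher sum. The square is linearized with an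
auxiliary Gaussian variable: `exp (l A²) = 𝔼 exp (√(2l) A Z)`. -/
lemma sum_exp_sq_sgn_le [DecidableEq ι] (e : ι → ℝ) (he : ∀ i, e i * e i = 1) {l : ℝ}
    (hl : 0 ≤ l) (hl1 : 2 * l * Fintype.card ι < 1) :
    ∑ u : ι → Bool, Real.exp (l * (∑ i, sgn (u i) * e i) ^ 2) ≤
      2 ^ Fintype.card ι * (Real.sqrt (1 - 2 * l * Fintype.card ι))⁻¹ := by
  obtain ⟨k, hk⟩ : ∃ k : ℝ, k = Fintype.card ι := ⟨_, rfl⟩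
  rw [← hk] at hl1 ⊢
  have h1 : ∀ A : ℝ, ENNReal.ofReal (Real.exp (l * A ^ 2)) =
      ∫⁻ z, ENNReal.ofReal (Real.exp (0 * z ^ 2 + Real.sqrt (2 * l) * A * z))
        ∂(gaussianReal 0 1) := by
    intro A
    rw [lintegral_exp_quadratic_gaussianReal _ _ _ (by simp)]
    congr 1
    rw [mul_pow, Real.sq_sqrt (by positivity)]
    simp only [mul_zero, sub_zero, Real.sqrt_one, inv_one, one_mul, NNReal.coe_one,
      mul_one]
    congr 1
    ring
  have h2 : ENNReal.ofReal (∑ u : ι → Bool, Real.exp (l * (∑ i, sgn (u i) * e i) ^ 2)) ≤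
      ENNReal.ofReal (2 ^ Fintype.card ι * (Real.sqrt (1 - 2 * l * k))⁻¹) := by
    rw [ENNReal.ofReal_sum_of_nonneg fun _ _ => (Real.exp_pos _).le]
    simp_rw [h1]
    rw [← lintegral_finsetSum _ fun u _ => by fun_prop]
    calc _ ≤ ∫⁻ z, ENNReal.ofReal (2 ^ Fintype.card ι) *
          ENNReal.ofReal (Real.exp (l * k * z ^ 2 + 0 * z)) ∂(gaussianReal 0 1) := by
          refine lintegral_mono fun z => ?_
          rw [← ENNReal.ofReal_sum_of_nonneg fun _ _ => (Real.exp_pos _).le,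
            ← ENNReal.ofReal_mul (by positivity)]
          refine ENNReal.ofReal_le_ofReal ?_
          have := sum_exp_sgn_le e he (Real.sqrt (2 * l) * z)
          rw [← hk, mul_pow, Real.sq_sqrt (by positivity)] at this
          refine le_trans (le_of_eq ?_) (this.trans (le_of_eq ?_))
          · refine Finset.sum_congr rfl fun u _ => ?_
            congr 1
            ring
          · congr 2
            ring
      _ = _ := by
          rw [lintegral_const_mul _ (by fun_prop), lintegral_exp_quadratic_gaussianReal _ _ _
            (by simpa [mul_assoc] using hl1), ← ENNReal.ofReal_mul (by positivity)]
          congr 2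
          simp [mul_assoc]
  exact (ENNReal.ofReal_le_ofReal_iff (by positivity)).1 h2

lemma ratio_le_exp_abs {s r : ℝ} (hr : r ≤ s) :
    (1 + s) / (1 + s - r) ≤ Real.exp |r| := by
  have h0 : 0 < 1 + s - r := by linarith
  rw [div_le_iff₀ h0]
  have h1 : 1 + |r| ≤ Real.exp |r| := by linarith [Real.add_one_le_exp |r|]
  have h2 : 1 + s ≤ (1 + |r|) * (1 + s - r) := by
    rcases le_total 0 r with h | h
    · rw [abs_of_nonneg h]; nlinarith
    · have : 0 ≤ |r| * (1 + s - r) := by positivity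
      nlinarith
  exact h2.trans (mul_le_mul_of_nonneg_right h1 h0.le)

/-- The averaged second moment of the likelihood ratios of the mixtures, bounded for signs `p`, `q`
whose overlaps are `s / d²` times a product of two Rademacher sums `A`, `B`. Each term is at most
`exp (n |r|) = exp (c |A B| / d)`, and `2 |A B| ≤ A² + B²` separates the two sums. -/
lemma sum_sum_ratio_pow_le {d n : ℕ} (hd : 0 < d) {s c : ℝ} (hs : 0 ≤ s) (hc : c < 1)
    (hns : n * s = c * d)
    (r : (Fin d → Bool) × (Fin d → Bool) → (Fin d → Bool) × (Fin d → Bool) → ℝ)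
    (hr : ∀ p q, r p q = s / d ^ 2 *
      ((∑ i, sgn (p.1 i) * sgn (q.1 i)) * ∑ i, sgn (p.2 i) * sgn (q.2 i)))
    (hrs : ∀ p q, r p q ≤ s) :
    ∑ p, ∑ q, ((1 + s) / (1 + s - r p q)) ^ n ≤
      (1 - c)⁻¹ * (Fintype.card ((Fin d → Bool) × (Fin d → Bool)) : ℝ) ^ 2 := by
  have hd' : (0 : ℝ) < d := by exact_mod_cast hd
  have hc0 : 0 ≤ c := by
    have : 0 ≤ c * d := hns ▸ by positivity
    exact nonneg_of_mul_nonneg_left this hd'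
  set l : ℝ := c / (2 * d) with hl
  have hl0 : 0 ≤ l := by positivity
  have hld : 2 * l * d = c := by rw [hl]; field_simp
  have hpt : ∀ p q, ((1 + s) / (1 + s - r q p)) ^ n ≤
      Real.exp (l * (∑ i, sgn (q.1 i) * sgn (p.1 i)) ^ 2) *
        Real.exp (l * (∑ i, sgn (q.2 i) * sgn (p.2 i)) ^ 2) := by
    intro p q
    set A := ∑ i, sgn (q.1 i) * sgn (p.1 i) with hA
    set B := ∑ i, sgn (q.2 i) * sgn (p.2 i) with hB
    have h0 : 0 < 1 + s - r q p := by linarith [hrs q p]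
    refine (pow_le_pow_left₀ (by positivity) (ratio_le_exp_abs (hrs q p)) n).trans ?_
    rw [← Real.exp_nat_mul, ← Real.exp_add, Real.exp_le_exp, hr q p, abs_mul,
      abs_of_nonneg (by positivity : 0 ≤ s / (d : ℝ) ^ 2), abs_mul]
    have e1 : (n : ℝ) * (s / d ^ 2 * (|A| * |B|)) = l * (2 * |A| * |B|) := by
      have : (n : ℝ) * (s / d ^ 2 * (|A| * |B|)) = n * s / d ^ 2 * (|A| * |B|) := by ring
      rw [this, hns, hl]
      field_simp
    rw [e1, ← mul_add]
    refine mul_le_mul_of_nonneg_left ?_ hl0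
    have := two_mul_le_add_sq |A| |B|
    rwa [sq_abs, sq_abs] at this
  have hin : ∀ e : Fin d → Bool, ∑ u : Fin d → Bool,
      Real.exp (l * (∑ i, sgn (u i) * sgn (e i)) ^ 2) ≤ 2 ^ d * (Real.sqrt (1 - c))⁻¹ := by
    intro e
    have := sum_exp_sq_sgn_le (fun i => sgn (e i)) (fun i => sgn_mul_self (e i)) hl0
      (by rw [Fintype.card_fin, hld]; exact hc)
    rwa [Fintype.card_fin, hld] at this
  rw [Finset.sum_comm]
  have hrow : ∀ p : (Fin d → Bool) × (Fin d → Bool), ∑ q, ((1 + s) / (1 + s - r q p)) ^ n ≤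
      (1 - c)⁻¹ * (Fintype.card ((Fin d → Bool) × (Fin d → Bool)) : ℝ) := by
    intro p
    calc ∑ q, ((1 + s) / (1 + s - r q p)) ^ n
        ≤ ∑ q : (Fin d → Bool) × (Fin d → Bool),
          Real.exp (l * (∑ i, sgn (q.1 i) * sgn (p.1 i)) ^ 2) *
          Real.exp (l * (∑ i, sgn (q.2 i) * sgn (p.2 i)) ^ 2) :=
          Finset.sum_le_sum fun q _ => hpt p q
      _ = (∑ u : Fin d → Bool, Real.exp (l * (∑ i, sgn (u i) * sgn (p.1 i)) ^ 2)) *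
          ∑ v : Fin d → Bool, Real.exp (l * (∑ i, sgn (v i) * sgn (p.2 i)) ^ 2) := by
          rw [Fintype.sum_prod_type, Finset.sum_mul_sum]
      _ ≤ (2 ^ d * (Real.sqrt (1 - c))⁻¹) * (2 ^ d * (Real.sqrt (1 - c))⁻¹) :=
          mul_le_mul (hin _) (hin _) (Finset.sum_nonneg fun _ _ => (Real.exp_pos _).le)
            (by positivity)
      _ = _ := by
          rw [mul_mul_mul_comm, ← mul_inv, Real.mul_self_sqrt (by linarith), mul_comm]
          simp
  calc _ ≤ ∑ _p : (Fin d → Bool) × (Fin d → Bool),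
        (1 - c)⁻¹ * (Fintype.card ((Fin d → Bool) × (Fin d → Bool)) : ℝ) :=
        Finset.sum_le_sum fun p _ => hrow p
    _ = _ := by
        rw [Finset.sum_const, Finset.card_univ, nsmul_eq_mul]
        ring

end Signs

/-! ### Separation in nuclear norm of signed Hadamard tiles -/

section NuclearNorm

variable {d : ℕ}

/-- The part of the duality between the nuclear and the operator norm that gives lower bounds: if
`A` has operator norm at most `L`, then `tr(Aᵀ M) ≤ L ‖M‖_*`. -/
lemma frob_le_mul_nuclearNorm {A : Mat d} {L : ℝ} (hL : 0 ≤ L)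
    (hA : ∀ x : Fin d → ℝ, ∑ i, (∑ k, A i k * x k) ^ 2 ≤ L ^ 2 * ∑ k, x k ^ 2) (M : Mat d) :
    frob A M ≤ L * nuclearNorm M := by
  set hM := Matrix.isHermitian_conjTranspose_mul_self M with hMdef
  set e := hM.eigenvectorBasis with he
  have hpars : ∀ i, ∑ k, A i k * M i k =
      ∑ j, (∑ k, A i k * e j k) * (∑ k, M i k * e j k) := by
    intro i
    have := e.sum_inner_mul_inner (WithLp.toLp 2 (A i)) (WithLp.toLp 2 (M i))
    simp only [PiLp.inner_apply, RCLike.inner_apply, conj_trivial] at this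
    rw [show ∑ k, A i k * M i k = ∑ k, M i k * A i k from
      Finset.sum_congr rfl fun _ _ => mul_comm _ _, ← this]
    refine Finset.sum_congr rfl fun j _ => ?_
    congr 1
    exact Finset.sum_congr rfl fun _ _ => mul_comm _ _
  have hone : ∀ j, ∑ k, e j k ^ 2 = 1 := by
    intro j
    have h := e.orthonormal.1 j
    have h2 := EuclideanSpace.real_norm_sq_eq (e j)
    rw [h] at h2
    linarith
  have hlam : ∀ j, ∑ i, (∑ k, M i k * e j k) ^ 2 = hM.eigenvalues j := by
    intro j
    have h := hM.mulVec_eigenvectorBasis j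
    have h1 : (⇑(e j)) ⬝ᵥ ((Mᴴ * M) *ᵥ ⇑(e j)) = hM.eigenvalues j := by
      rw [h, dotProduct_smul]
      have : (⇑(e j)) ⬝ᵥ (⇑(e j)) = 1 := by
        rw [← hone j]
        exact Finset.sum_congr rfl fun _ _ => (sq _).symm
      rw [this]; simp
    rw [← h1, ← Matrix.mulVec_mulVec, Matrix.dotProduct_mulVec,
      Matrix.conjTranspose_eq_transpose_of_trivial, Matrix.vecMul_transpose]
    exact Finset.sum_congr rfl fun _ _ => sq _
  calc frob A M = ∑ j, ∑ i, (∑ k, A i k * e j k) * (∑ k, M i k * e j k) := by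
        unfold frob
        simp_rw [hpars]
        exact Finset.sum_comm
    _ ≤ ∑ j, L * Real.sqrt (hM.eigenvalues j) := by
        refine Finset.sum_le_sum fun j _ => ?_
        refine (Real.sum_mul_le_sqrt_mul_sqrt _ _ _).trans ?_
        rw [hlam]
        refine mul_le_mul_of_nonneg_right ?_ (Real.sqrt_nonneg _)
        rw [Real.sqrt_le_left hL]
        have := hA (e j)
        rwa [hone, mul_one] at this
    _ = L * nuclearNorm M := by rw [← Finset.mul_sum]; rfl

end NuclearNorm

section Hadamard

/-- The Sylvester–Hadamard matrix with rows and columns indexed by bit strings: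
`W x y = (-1)^⟨x, y⟩`. -/
def walsh {m : ℕ} (x y : Fin m → Bool) : ℝ := ∏ i, if x i && y i then -1 else 1

lemma walsh_mul_self {m : ℕ} (x y : Fin m → Bool) : walsh x y * walsh x y = 1 := by
  unfold walsh
  rw [← Finset.prod_mul_distrib]
  exact Finset.prod_eq_one fun i _ => by split_ifs <;> norm_num

lemma sum_walsh_mul_walsh {m : ℕ} (y y' : Fin m → Bool) :
    ∑ x, walsh x y * walsh x y' = if y = y' then (2 : ℝ) ^ m else 0 := by
  unfold walsh
  simp_rw [← Finset.prod_mul_distrib]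
  have h := Finset.prod_univ_sum (fun _ : Fin m => (Finset.univ : Finset Bool))
    fun i c => (if c && y i then (-1 : ℝ) else 1) * (if c && y' i then -1 else 1)
  rw [Fintype.piFinset_univ] at h
  rw [← h]
  have h2 : ∀ i, ∑ c : Bool, (if c && y i then (-1 : ℝ) else 1) * (if c && y' i then -1 else 1) =
      if y i = y' i then 2 else 0 := by
    intro i
    rw [Fintype.sum_bool]
    cases y i <;> cases y' i <;> norm_num
  simp_rw [h2]
  rw [Finset.prod_ite_zero]
  simp [funext_iff]

lemma sum_sq_walsh {m : ℕ} (w : (Fin m → Bool) → ℝ) :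
    ∑ x, (∑ y, walsh x y * w y) ^ 2 = 2 ^ m * ∑ y, w y ^ 2 := by
  have h : ∀ x : Fin m → Bool, (∑ y, walsh x y * w y) ^ 2 =
      ∑ y, ∑ y', (w y * w y') * (walsh x y * walsh x y') := by
    intro x
    rw [sq, Finset.sum_mul_sum]
    exact Finset.sum_congr rfl fun _ _ => Finset.sum_congr rfl fun _ _ => by ring
  simp_rw [h]
  rw [Finset.sum_comm, Finset.mul_sum]
  refine Finset.sum_congr rfl fun y _ => ?_
  rw [Finset.sum_comm]
  simp_rw [← Finset.mul_sum, sum_walsh_mul_walsh]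
  simp
  ring

/-- Tiling the Hadamard matrix with at most `N` copies of each row and column multiplies its
operator norm `√(2 ^ m)` by at most `N`. -/
lemma sum_sq_tiled_le {m d : ℕ} (g : Fin d → Fin m → Bool) {N : ℝ}
    (hg : ∀ β, ((Finset.univ.filter fun i => g i = β).card : ℝ) ≤ N) (x : Fin d → ℝ) :
    ∑ i, (∑ j, walsh (g i) (g j) * x j) ^ 2 ≤ N ^ 2 * 2 ^ m * ∑ j, x j ^ 2 := by
  have hN : 0 ≤ N := (Nat.cast_nonneg _).trans (hg fun _ => true)
  set w : (Fin m → Bool) → ℝ := fun β => ∑ j with g j = β, x j with hw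
  set Z : (Fin m → Bool) → ℝ := fun α => ∑ β, walsh α β * w β with hZ
  have h1 : ∀ i, ∑ j, walsh (g i) (g j) * x j = Z (g i) := by
    intro i
    simp only [hZ, hw, Finset.mul_sum]
    rw [← Finset.sum_fiberwise Finset.univ g]
    refine Finset.sum_congr rfl fun β _ => Finset.sum_congr rfl fun j hj => ?_
    rw [(Finset.mem_filter.1 hj).2]
  have h2 : ∀ β, w β ^ 2 ≤ N * ∑ j with g j = β, x j ^ 2 := fun β =>
    sq_sum_le_card_mul_sum_sq.trans
      (mul_le_mul_of_nonneg_right (hg β) (Finset.sum_nonneg fun _ _ => sq_nonneg _))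
  simp_rw [h1]
  calc ∑ i, Z (g i) ^ 2 = ∑ β, ∑ i with g i = β, Z (g i) ^ 2 :=
        (Finset.sum_fiberwise Finset.univ g _).symm
    _ = ∑ β, ((Finset.univ.filter fun i => g i = β).card : ℝ) * Z β ^ 2 := by
        refine Finset.sum_congr rfl fun β _ => ?_
        rw [← nsmul_eq_mul, ← Finset.sum_const]
        refine Finset.sum_congr rfl fun j hj => ?_
        rw [(Finset.mem_filter.1 hj).2]
    _ ≤ ∑ β, N * Z β ^ 2 :=
        Finset.sum_le_sum fun β _ => mul_le_mul_of_nonneg_right (hg β) (sq_nonneg _)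
    _ = N * (2 ^ m * ∑ β, w β ^ 2) := by rw [← Finset.mul_sum, sum_sq_walsh]
    _ ≤ N * (2 ^ m * ∑ β, N * ∑ j with g j = β, x j ^ 2) := by
        gcongr with β
        exact h2 β
    _ = _ := by
        rw [← Finset.mul_sum, Finset.sum_fiberwise]
        ring

/-- The indices `0, …, d - 1` can be distributed evenly over the `2 ^ m` bit strings. -/
lemma exists_even_tiling {m d : ℕ} (h : 2 ^ m ≤ d) :
    ∃ g : Fin d → Fin m → Bool, ∀ β,
      ((Finset.univ.filter fun i => g i = β).card : ℝ) ≤ 2 * d / 2 ^ m := by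
  have hK : 0 < 2 ^ m := by positivity
  let eqv : Fin (2 ^ m) ≃ (Fin m → Bool) := Fintype.equivOfCardEq (by simp)
  refine ⟨fun i => eqv ⟨i % 2 ^ m, Nat.mod_lt _ hK⟩, fun β => ?_⟩
  have hcard : (Finset.univ.filter fun i : Fin d => eqv ⟨i % 2 ^ m, Nat.mod_lt _ hK⟩ = β).card ≤
      d / 2 ^ m + 1 := by
    rw [← Finset.card_range (d / 2 ^ m + 1)]
    refine Finset.card_le_card_of_injOn (fun i => (i : ℕ) / 2 ^ m) ?_ ?_
    · intro i _
      simp only [Finset.coe_range, Set.mem_Iio]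
      exact Nat.lt_succ_of_le (Nat.div_le_div_right i.2.le)
    · intro i hi j hj hij
      simp only [Finset.coe_filter, Finset.mem_univ, true_and, Set.mem_ofPred_eq] at hi hj
      have h1 := congrArg Fin.val (eqv.injective (hi.trans hj.symm))
      simp only at h1 hij
      ext
      rw [← Nat.div_add_mod (i : ℕ) (2 ^ m), ← Nat.div_add_mod (j : ℕ) (2 ^ m), h1, hij]
  have h1 : ((d / 2 ^ m : ℕ) : ℝ) ≤ d / 2 ^ m := by
    have := @Nat.cast_div_le ℝ _ _ _ d (2 ^ m)
    simpa using this
  have h2 : (1 : ℝ) ≤ d / 2 ^ m := by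
    rw [le_div_iff₀ (by positivity), one_mul]
    exact_mod_cast h
  calc _ ≤ (((d / 2 ^ m + 1 : ℕ)) : ℝ) := by exact_mod_cast hcard
    _ ≤ d / 2 ^ m + d / 2 ^ m := by push_cast; linarith
    _ = _ := by ring

/-- The matrices `a · D_u H D_v`, with `H` the Sylvester–Hadamard matrix tiled according to `g` and
`D_u`, `D_v` the diagonal matrices of the signs `p = (u, v)`. For `m = 0` these are the rank one
matrices `a · u vᵀ`. -/
def signedTile {m d : ℕ} (a : ℝ) (g : Fin d → Fin m → Bool) (p : (Fin d → Bool) × (Fin d → Bool)) :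
    Mat d :=
  Matrix.of fun i j => a * (sgn (p.1 i) * walsh (g i) (g j) * sgn (p.2 j))

variable {m d : ℕ} (a : ℝ) (g : Fin d → Fin m → Bool)

lemma rank_signedTile_le (p : (Fin d → Bool) × (Fin d → Bool)) :
    (signedTile a g p).rank ≤ 2 ^ m := by
  have h : signedTile a g p =
      (Matrix.of fun i β => a * (sgn (p.1 i) * walsh (g i) β)) *
        (Matrix.of fun β j => if β = g j then sgn (p.2 j) else 0) := by
    ext i j
    simp [signedTile, Matrix.mul_apply, mul_assoc]
  rw [h]
  refine (Matrix.rank_mul_le_left _ _).trans ((Matrix.rank_le_card_width _).trans ?_)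
  simp

/-- The overlaps of the signed tiles depend on the signs alone, and not on the tiled matrix. -/
lemma frob_signedTile (p q : (Fin d → Bool) × (Fin d → Bool)) :
    frob (signedTile a g p) (signedTile a g q) = a ^ 2 *
      ((∑ i, sgn (p.1 i) * sgn (q.1 i)) * ∑ i, sgn (p.2 i) * sgn (q.2 i)) := by
  rw [Finset.sum_mul_sum, Finset.mul_sum]
  refine Finset.sum_congr rfl fun i _ => ?_
  rw [Finset.mul_sum]
  refine Finset.sum_congr rfl fun j _ => ?_
  simp only [signedTile, Matrix.of_apply]
  linear_combination (a ^ 2 * sgn (p.1 i) * sgn (q.1 i) * sgn (p.2 j) * sgn (q.2 j)) *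
    walsh_mul_self (g i) (g j)

lemma frob_signedTile_self (p : (Fin d → Bool) × (Fin d → Bool)) :
    frob (signedTile a g p) (signedTile a g p) = a ^ 2 * d ^ 2 := by
  rw [frob_signedTile]
  simp [sgn_mul_self, sq]

lemma signedTile_opNorm_le {N : ℝ}
    (hg : ∀ β, ((Finset.univ.filter fun i => g i = β).card : ℝ) ≤ N)
    (p : (Fin d → Bool) × (Fin d → Bool)) (x : Fin d → ℝ) :
    ∑ i, (∑ k, signedTile a g p i k * x k) ^ 2 ≤ a ^ 2 * (N ^ 2 * 2 ^ m) * ∑ k, x k ^ 2 := by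
  have h := sum_sq_tiled_le g hg fun k => sgn (p.2 k) * x k
  have h1 : ∑ k, (sgn (p.2 k) * x k) ^ 2 = ∑ k, x k ^ 2 :=
    Finset.sum_congr rfl fun k _ => by rw [mul_pow, sq (sgn _), sgn_mul_self, one_mul]
  rw [h1] at h
  rw [mul_assoc]
  refine le_trans (le_of_eq ?_) (mul_le_mul_of_nonneg_left h (sq_nonneg a))
  rw [Finset.mul_sum]
  refine Finset.sum_congr rfl fun i _ => ?_
  have h2 : ∑ k, signedTile a g p i k * x k =
      (a * sgn (p.1 i)) * ∑ k, walsh (g i) (g k) * (sgn (p.2 k) * x k) := by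
    rw [Finset.mul_sum]
    refine Finset.sum_congr rfl fun k _ => ?_
    simp only [signedTile, Matrix.of_apply]
    ring
  rw [h2, mul_pow, mul_pow, sq (sgn _), sgn_mul_self, mul_one]

end Hadamard

/-- The signed rank one matrices and the signed tiles of rank at most `2 ^ m` with the same Frobenius norm `t`
have nuclear distance at least of order `t √(2 ^ m)`. -/
lemma nuclearNorm_signedTile_sub_ge {m d : ℕ} (hd : 0 < d) (hm : (16 : ℝ) ≤ 2 ^ m) {t : ℝ}
    (ht : 0 < t) (g : Fin d → Fin m → Bool) (g₀ : Fin d → Fin 0 → Bool)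
    (hg : ∀ β, ((Finset.univ.filter fun i => g i = β).card : ℝ) ≤ 2 * d / 2 ^ m)
    (p q : (Fin d → Bool) × (Fin d → Bool)) :
    t * Real.sqrt (2 ^ m) / 4 ≤
      nuclearNorm (signedTile (t / d) g p - signedTile (t / d) g₀ q) := by
  have hd' : (0 : ℝ) < d := by exact_mod_cast hd
  set R : ℝ := Real.sqrt (2 ^ m) with hR
  have hR2 : R ^ 2 = 2 ^ m := Real.sq_sqrt (by positivity)
  have hR4 : 4 ≤ R := Real.le_sqrt_of_sq_le (by linarith)
  have hR0 : 0 < R := by linarith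
  set A := signedTile (t / d) g p with hA
  set B := signedTile (t / d) g₀ q with hB
  set L : ℝ := 2 * t / R with hL
  have hop : ∀ x : Fin d → ℝ, ∑ i, (∑ k, A i k * x k) ^ 2 ≤ L ^ 2 * ∑ k, x k ^ 2 := by
    intro x
    refine (signedTile_opNorm_le (t / d) g hg p x).trans (le_of_eq ?_)
    rw [← hR2, hL]
    field_simp
  -- the tile `A` is almost orthogonal to the rank one matrix `B`
  have hAB : frob A B ≤ L * t := by
    have h1 : frob A B = ∑ i, (t / d * sgn (q.1 i)) * ∑ k, A i k * sgn (q.2 k) := by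
      unfold frob
      refine Finset.sum_congr rfl fun i _ => ?_
      rw [Finset.mul_sum]
      refine Finset.sum_congr rfl fun k _ => ?_
      simp only [hB, signedTile, Matrix.of_apply, walsh, Finset.univ_eq_empty, Finset.prod_empty]
      ring
    have h2 : ∑ i : Fin d, (t / d * sgn (q.1 i)) ^ 2 = t ^ 2 / d := by
      simp_rw [mul_pow, sq (sgn _), sgn_mul_self]
      simp
      field_simp
    have h3 := hop fun k => sgn (q.2 k)
    have h4 : ∑ k : Fin d, sgn (q.2 k) ^ 2 = d := by
      simp_rw [sq, sgn_mul_self]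
      simp
    rw [h4] at h3
    rw [h1]
    refine (Real.sum_mul_le_sqrt_mul_sqrt _ _ _).trans ?_
    rw [h2]
    refine (mul_le_mul_of_nonneg_left (Real.sqrt_le_sqrt h3) (Real.sqrt_nonneg _)).trans ?_
    rw [← Real.sqrt_mul (by positivity)]
    have : t ^ 2 / d * (L ^ 2 * d) = (L * t) ^ 2 := by field_simp
    rw [this, Real.sqrt_sq (by positivity)]
  have hAA : frob A A = t ^ 2 := by
    rw [hA, frob_signedTile_self]
    field_simp
  have hsub : frob A (A - B) = frob A A - frob A B := by
    simp only [frob, Matrix.sub_apply, mul_sub, Finset.sum_sub_distrib]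
  have hmain := frob_le_mul_nuclearNorm (by positivity : 0 ≤ L) hop (A - B)
  rw [hsub, hAA] at hmain
  have h5 : L * t ≤ t ^ 2 / 2 := by
    rw [hL]
    have : 2 * t / R ≤ t / 2 := by
      rw [div_le_iff₀ hR0]
      nlinarith
    nlinarith
  have h6 : t ^ 2 / 2 ≤ L * nuclearNorm (A - B) := by linarith
  have h7 : L * (t * R / 4) = t ^ 2 / 2 := by rw [hL]; field_simp; norm_num
  rw [← h7] at h6
  exact le_of_mul_le_mul_left h6 (by positivity)

/-! ### Lower bounds for the diameter -/

/-- If `C` covers every matrix of rank at most `k` with probability at least `1 - β`, then some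
matrix of rank one has a large confidence set with probability at least `1 - 2β - 2δ`: under a
mixture over rank one matrices, `C` contains one of them with probability `1 - β`, and it also
contains one of the tiles of rank at most `k` with probability `1 - β - 2δ`, because the mixture
over these is within `2δ` of the first one. -/
lemma exists_rank_one_large_diam {n d k : ℕ} (hn : 0 < n) (hk : 16 ≤ k) (hkd : k ≤ d) {δ β : ℝ}
    (hδ : 0 < δ) (hδ1 : δ ≤ 1) (C : ConfidenceSet)
    (hC : ∀ θ ∈ lowRank d k, 1 - β ≤ (obsLaw n θ).real {z | θ ∈ C.set n d z}) :
    ∃ θ ∈ lowRank d 1, ∃ E : Set (Obs n d), MeasurableSet E ∧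
      1 - 2 * β - 2 * δ ≤ (obsLaw n θ).real E ∧
      ∀ z ∈ E, ENNReal.ofReal (δ / 8 * Real.sqrt ((k : ℝ) * d / n)) ≤
        nuclearDiam (C.set n d z) := by
  have hd : 0 < d := by omega
  have hd' : (0 : ℝ) < d := by exact_mod_cast hd
  have hn' : (0 : ℝ) < n := by exact_mod_cast hn
  set m := Nat.log 2 k with hm
  have hmk : 2 ^ m ≤ k := Nat.pow_log_le_self 2 (by omega)
  have hkm : k < 2 ^ (m + 1) := Nat.lt_pow_succ_log_self (by norm_num) k
  have hm16 : (16 : ℝ) ≤ 2 ^ m := by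
    have h4 : 4 ≤ m := Nat.le_log_of_pow_le (by norm_num) (by simpa using hk)
    calc (16 : ℝ) = 2 ^ 4 := by norm_num
      _ ≤ 2 ^ m := pow_le_pow_right₀ (by norm_num) h4
  obtain ⟨g, hg⟩ := exists_even_tiling (hmk.trans hkd)
  let g₀ : Fin d → Fin 0 → Bool := fun _ => Fin.elim0
  -- the squared Frobenius norm `s = δ² d / (2n)` is at the edge of detectability
  set s : ℝ≥0 := ⟨δ ^ 2 / 2 * d / n, by positivity⟩ with hs
  have hsc : (s : ℝ) = δ ^ 2 / 2 * d / n := rfl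
  have hs0 : (0 : ℝ) < s := by rw [hsc]; positivity
  set t : ℝ := Real.sqrt s with ht
  have ht0 : 0 < t := Real.sqrt_pos.2 hs0
  have ht2 : t ^ 2 = s := Real.sq_sqrt hs0.le
  have hself : ∀ {m' : ℕ} (g' : Fin d → Fin m' → Bool) p,
      frob (signedTile (t / d) g' p) (signedTile (t / d) g' p) = s := by
    intro m' g' p
    rw [frob_signedTile_self, ← ht2]
    field_simp
  have htv : ∀ {m' : ℕ} (g' : Fin d → Fin m' → Bool) {A : Set (Obs n d)}, MeasurableSet A →
      |(∑ p, (obsLaw n (signedTile (t / d) g' p)).real A) /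
        Fintype.card ((Fin d → Bool) × (Fin d → Bool)) - (refLaw n d s).real A| ≤ δ := by
    intro m' g' A hA
    refine abs_avg_obsLaw_sub_refLaw_le (hself g') hδ ?_ hA
    have hc : δ ^ 2 / 2 < 1 := by nlinarith
    refine (sum_sum_ratio_pow_le hd hs0.le hc (by rw [hsc]; field_simp) _ (fun p q => ?_)
      fun p q => ?_).trans ?_
    · rw [frob_signedTile, div_pow, ht2]
    · have h := frob_self_nonneg (signedTile (t / d) g' p - signedTile (t / d) g' q)
      rw [frob_sub_sub, hself, hself] at h
      linarith
    · refine mul_le_mul_of_nonneg_right ?_ (by positivity)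
      rw [inv_le_iff_one_le_mul₀ (by linarith)]
      have : δ ^ 2 ≤ 1 := by nlinarith
      nlinarith [sq_nonneg δ]
  let A : {m' : ℕ} → (Fin d → Fin m' → Bool) → Set (Obs n d) := fun g' =>
    ⋃ p, {z | signedTile (t / d) g' p ∈ C.set n d z}
  have hA : ∀ {m' : ℕ} (g' : Fin d → Fin m' → Bool), MeasurableSet (A g') := fun g' =>
    MeasurableSet.iUnion fun p => C.measurableSet_mem n d _
  have hcov : ∀ {m' : ℕ} (g' : Fin d → Fin m' → Bool), 2 ^ m' ≤ k → ∀ p,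
      1 - β ≤ (obsLaw n (signedTile (t / d) g' p)).real (A g') := by
    intro m' g' hm' p
    refine (hC _ ((rank_signedTile_le _ _ _).trans hm')).trans (measureReal_mono ?_)
    exact Set.subset_iUnion (fun p => {z | signedTile (t / d) g' p ∈ C.set n d z}) p
  set N : ℝ := ((Fintype.card ((Fin d → Bool) × (Fin d → Bool)) : ℕ) : ℝ) with hN
  have hN0 : 0 < N := by
    rw [hN]
    exact Nat.cast_pos.2 Fintype.card_pos
  have hsumconst : ∀ x : ℝ, ∑ _p : (Fin d → Bool) × (Fin d → Bool), x = N * x := fun x => by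
    rw [Finset.sum_const, Finset.card_univ, nsmul_eq_mul]
  have h1 : 1 - β ≤ (∑ p, (obsLaw n (signedTile (t / d) g p)).real (A g)) / N := by
    rw [le_div_iff₀ hN0, mul_comm, ← hsumconst]
    exact Finset.sum_le_sum fun p _ => hcov g hmk p
  have h2 : 1 - β - 2 * δ ≤ (∑ q, (obsLaw n (signedTile (t / d) g₀ q)).real (A g)) / N := by
    have e1 := abs_le.1 (htv g (hA g))
    have e0 := abs_le.1 (htv g₀ (hA g))
    linarith [e1.1, e1.2, e0.1, e0.2]
  have h3 : ∑ _q : (Fin d → Bool) × (Fin d → Bool), (1 - 2 * β - 2 * δ) ≤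
      ∑ q, (obsLaw n (signedTile (t / d) g₀ q)).real (A g₀ ∩ A g) := by
    rw [le_div_iff₀ hN0] at h2
    have : ∑ q, ((1 - β) + (obsLaw n (signedTile (t / d) g₀ q)).real (A g) - 1) ≤
        ∑ q, (obsLaw n (signedTile (t / d) g₀ q)).real (A g₀ ∩ A g) := by
      refine Finset.sum_le_sum fun q _ => ?_
      have h4 := measureReal_union_add_inter (μ := obsLaw n (signedTile (t / d) g₀ q))
        (s := A g₀) (hA g)
      have h5 : (obsLaw n (signedTile (t / d) g₀ q)).real (A g₀ ∪ A g) ≤ 1 := measureReal_le_one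
      have h6 := hcov g₀ (by simp; omega) q
      linarith
    rw [Finset.sum_sub_distrib, Finset.sum_add_distrib, hsumconst, hsumconst] at this
    rw [hsumconst]
    linarith
  obtain ⟨q, -, hq⟩ := Finset.exists_le_of_sum_le Finset.univ_nonempty h3
  refine ⟨_, (rank_signedTile_le (t / d) g₀ q).trans (by simp), _, (hA g₀).inter (hA g), hq, ?_⟩
  rintro z ⟨hz0, hz1⟩
  obtain ⟨q', hq'⟩ := Set.mem_iUnion.1 hz0
  obtain ⟨p', hp'⟩ := Set.mem_iUnion.1 hz1
  have hdist := nuclearNorm_signedTile_sub_ge hd hm16 ht0 g g₀ hg p' q'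
  have hnum : δ / 8 * Real.sqrt ((k : ℝ) * d / n) ≤ t * Real.sqrt (2 ^ m) / 4 := by
    have e : t * Real.sqrt (2 ^ m) = Real.sqrt (s * 2 ^ m) := by
      rw [ht, ← Real.sqrt_mul hs0.le]
    have e2 : Real.sqrt ((δ / 2) ^ 2 * ((k : ℝ) * d / n)) ≤ Real.sqrt (s * 2 ^ m) := by
      refine Real.sqrt_le_sqrt ?_
      have hk2 : (k : ℝ) ≤ 2 * 2 ^ m := by
        have : (k : ℝ) ≤ 2 ^ (m + 1) := by exact_mod_cast hkm.le
        rwa [pow_succ, mul_comm] at this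
      rw [hsc]
      calc (δ / 2) ^ 2 * ((k : ℝ) * d / n) = δ ^ 2 / 4 * d / n * k := by ring
        _ ≤ δ ^ 2 / 4 * d / n * (2 * 2 ^ m) := by gcongr
        _ = _ := by ring
    rw [Real.sqrt_mul (by positivity), Real.sqrt_sq (by positivity)] at e2
    rw [e]
    linarith
  refine (ENNReal.ofReal_le_ofReal (hnum.trans hdist)).trans ?_
  unfold nuclearDiam
  exact le_iSup₂_of_le _ hp' (le_iSup₂_of_le _ hq' le_rfl)

/-- The asymptotic form of `exists_rank_one_large_diam` for honest confidence sets. -/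
lemma eventually_exists_rank_one_large_diam {α : ℝ} (hα₀ : 0 < α) (hα₁ : α < 1 / 3)
    (C : ConfidenceSet) {Θ : (n d : ℕ) → Set (Mat d)} (hC : C.AsymptoticallyHonest α Θ)
    {k : ℕ → ℕ → ℕ} (hkΘ : ∀ n d, lowRank d (k n d) ⊆ Θ n d)
    (hk : ∀ᶠ p : ℕ × ℕ in atTop, 16 ≤ k p.1 p.2 ∧ k p.1 p.2 ≤ p.2) :
    ∀ᶠ p : ℕ × ℕ in atTop, ∃ θ ∈ lowRank p.2 1, ∃ E : Set (Obs p.1 p.2), MeasurableSet E ∧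
      α < (obsLaw p.1 θ).real E ∧
      ∀ z ∈ E, ENNReal.ofReal ((1 - 3 * α) / 32 * Real.sqrt ((k p.1 p.2 : ℝ) * p.2 / p.1)) ≤
        nuclearDiam (C.set p.1 p.2 z) := by
  set η : ℝ := 1 - 3 * α with hη
  have hη0 : 0 < η := by linarith
  have hlt : ENNReal.ofReal (1 - (α + η / 8)) < ENNReal.ofReal (1 - α) :=
    (ENNReal.ofReal_lt_ofReal_iff (by linarith)).2 (by linarith)
  filter_upwards [eventually_lt_of_lt_liminf (hlt.trans_le hC), hk,
    eventually_ge_atTop ((1, 1) : ℕ × ℕ)] with p hp hkp hp1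
  have hcov : ∀ θ ∈ lowRank p.2 (k p.1 p.2), 1 - (α + η / 8) ≤
      (obsLaw p.1 θ).real {z | θ ∈ C.set p.1 p.2 z} := by
    intro θ hθ
    have h := hp.le.trans (iInf₂_le θ (hkΘ _ _ hθ))
    exact (ENNReal.ofReal_le_iff_le_toReal (measure_ne_top _ _)).1 h
  obtain ⟨θ, hθ, E, hE, hPE, hdiam⟩ := exists_rank_one_large_diam (δ := η / 4) hp1.1 hkp.1 hkp.2
    (by linarith) (by linarith) C hcov
  -- the probability is at least `1 - 2 (α + η / 8) - 2 (η / 4) = α + η / 4`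
  refine ⟨θ, hθ, E, hE, by linarith, fun z hz => le_trans (le_of_eq ?_) (hdiam z hz)⟩
  congr 2
  ring

lemma lowRank_mono {d k k' : ℕ} (h : k ≤ k') : lowRank d k ⊆ lowRank d k' :=
  fun _ hθ => le_trans (α := ℕ) hθ h

lemma ofReal_mul_le_expectedDiam (C : ConfidenceSet) {n d : ℕ} {θ : Mat d} {E : Set (Obs n d)}
    (hE : MeasurableSet E) {α ρ : ℝ} (hα : 0 ≤ α) (hαE : α ≤ (obsLaw n θ).real E)
    (h : ∀ z ∈ E, ENNReal.ofReal ρ ≤ nuclearDiam (C.set n d z)) :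
    ENNReal.ofReal (α * ρ) ≤ C.expectedDiam n θ := by
  rw [ENNReal.ofReal_mul hα, mul_comm]
  calc ENNReal.ofReal ρ * ENNReal.ofReal α ≤ ENNReal.ofReal ρ * obsLaw n θ E :=
        mul_le_mul_right (ENNReal.ofReal_le_of_le_toReal hαE) _
    _ = ∫⁻ z, E.indicator (fun _ => ENNReal.ofReal ρ) z ∂(obsLaw n θ) := by
        rw [lintegral_indicator_const hE]
    _ ≤ C.expectedDiam n θ := by
        refine lintegral_mono fun z => ?_
        by_cases hz : z ∈ E
        · rw [Set.indicator_of_mem hz]; exact h z hz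
        · rw [Set.indicator_of_notMem hz]; exact zero_le

end TraceRegression

open TraceRegression in
theorem theorem2 (α : ℝ) (hα₀ : 0 < α) (hα₁ : α < 1 / 3) :
    (∃ c : ℝ, 0 < c ∧
      ∀ k₁ : ℕ → ℕ → ℕ,
        Tendsto (fun p : ℕ × ℕ => k₁ p.1 p.2) atTop atTop →
        (fun p : ℕ × ℕ => (k₁ p.1 p.2 : ℝ)) =o[atTop] (fun p : ℕ × ℕ => (p.2 : ℝ)) →
      ∀ C : ConfidenceSet,
        C.AsymptoticallyHonest α (fun n d => lowRank d (k₁ n d)) →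
      ∀ k₀ : ℕ → ℕ → ℕ,
        (∀ᶠ p : ℕ × ℕ in atTop, 1 ≤ k₀ p.1 p.2) →
        (fun p : ℕ × ℕ => (k₀ p.1 p.2 : ℝ)) =o[atTop] (fun p : ℕ × ℕ => (k₁ p.1 p.2 : ℝ)) →
        ∀ᶠ p : ℕ × ℕ in atTop,
          ENNReal.ofReal (c * Real.sqrt ((k₁ p.1 p.2 : ℝ) * p.2 / p.1)) ≤
            (⨆ θ ∈ lowRank p.2 (k₀ p.1 p.2), C.expectedDiam p.1 θ)) ∧
    (∀ k₀ : ℕ → ℕ → ℕ,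
        (∀ᶠ p : ℕ × ℕ in atTop, 1 ≤ k₀ p.1 p.2) →
        (fun p : ℕ × ℕ => (k₀ p.1 p.2 : ℝ)) =o[atTop]
          (fun p : ℕ × ℕ => Real.sqrt (p.2 : ℝ)) →
      ¬ ∃ C : ConfidenceSet,
          C.AsymptoticallyHonest α (fun _ _ => Set.univ) ∧
          (C.AdaptsInExpectation k₀ ∨ C.AdaptsInProbability α k₀)) := by
  have hη : 0 < 1 - 3 * α := by linarith
  constructor
  · refine ⟨α * ((1 - 3 * α) / 32), by positivity, ?_⟩
    intro k₁ hk₁ hk₁d C hC k₀ hk₀ _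
    have hk : ∀ᶠ p : ℕ × ℕ in atTop, 16 ≤ k₁ p.1 p.2 ∧ k₁ p.1 p.2 ≤ p.2 := by
      filter_upwards [hk₁.eventually_ge_atTop 16, hk₁d.def one_pos] with p h1 h2
      refine ⟨h1, ?_⟩
      simpa using h2
    filter_upwards [eventually_exists_rank_one_large_diam hα₀ hα₁ C hC
      (fun _ _ => subset_rfl) hk, hk₀] with p hp h0
    obtain ⟨θ, hθ, E, hE, hPE, hdiam⟩ := hp
    rw [mul_assoc]
    exact (ofReal_mul_le_expectedDiam C hE hα₀.le hPE.le hdiam).trans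
      (le_iSup₂_of_le θ (lowRank_mono h0 hθ) le_rfl)
  · rintro k₀ hk₀ hk₀d ⟨C, hC, hadapt⟩
    have hk : ∀ᶠ p : ℕ × ℕ in atTop, 16 ≤ p.2 ∧ p.2 ≤ p.2 := by
      filter_upwards [eventually_ge_atTop ((1, 16) : ℕ × ℕ)] with p hp
      exact ⟨hp.2, le_rfl⟩
    have hmain := eventually_exists_rank_one_large_diam hα₀ hα₁ C hC (k := fun _ d => d)
      (fun _ _ => Set.subset_univ _) hk
    -- for large `d`, the rate `K k₀ √(d/n)` is smaller than the lower bound for `k₁ = d`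
    have hrate : ∀ K : ℝ, ∀ᶠ p : ℕ × ℕ in atTop,
        K * (k₀ p.1 p.2 * Real.sqrt ((p.2 : ℝ) / p.1)) <
          α * ((1 - 3 * α) / 32 * Real.sqrt ((p.2 : ℝ) * p.2 / p.1)) := by
      intro K
      have hε : 0 < α * (1 - 3 * α) / (64 * (|K| + 1)) := by positivity
      filter_upwards [hk₀d.def hε, eventually_ge_atTop ((1, 1) : ℕ × ℕ)] with p h1 hp
      have hn : (0 : ℝ) < p.1 := by exact_mod_cast hp.1
      have hd : (0 : ℝ) < p.2 := by exact_mod_cast hp.2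
      rw [Real.norm_of_nonneg (Nat.cast_nonneg _), Real.norm_of_nonneg (Real.sqrt_nonneg _)] at h1
      have hsd : 0 < Real.sqrt (p.2 : ℝ) := Real.sqrt_pos.2 hd
      have hsr : 0 < Real.sqrt ((p.2 : ℝ) / p.1) := Real.sqrt_pos.2 (by positivity)
      have h2 : K * k₀ p.1 p.2 < α * ((1 - 3 * α) / 32) * Real.sqrt (p.2 : ℝ) := by
        calc K * k₀ p.1 p.2 ≤ (|K| + 1) * k₀ p.1 p.2 := by
              gcongr
              linarith [le_abs_self K]
          _ ≤ (|K| + 1) * (α * (1 - 3 * α) / (64 * (|K| + 1)) * Real.sqrt (p.2 : ℝ)) := by gcongr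
          _ = α * (1 - 3 * α) / 64 * Real.sqrt (p.2 : ℝ) := by field_simp
          _ < α * ((1 - 3 * α) / 32) * Real.sqrt (p.2 : ℝ) := by
              refine mul_lt_mul_of_pos_right ?_ hsd
              have : 0 < α * (1 - 3 * α) := by positivity
              linarith
      rw [mul_div_assoc, Real.sqrt_mul hd.le]
      calc _ = K * k₀ p.1 p.2 * Real.sqrt ((p.2 : ℝ) / p.1) := by ring
        _ < α * ((1 - 3 * α) / 32) * Real.sqrt (p.2 : ℝ) * Real.sqrt ((p.2 : ℝ) / p.1) :=
            mul_lt_mul_of_pos_right h2 hsr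
        _ = _ := by ring
    have hpos : ∀ᶠ p : ℕ × ℕ in atTop,
        0 < (1 - 3 * α) / 32 * Real.sqrt ((p.2 : ℝ) * p.2 / p.1) := by
      filter_upwards [eventually_ge_atTop ((1, 1) : ℕ × ℕ)] with p hp
      have hn : (0 : ℝ) < p.1 := by exact_mod_cast hp.1
      have hd : (0 : ℝ) < p.2 := by exact_mod_cast hp.2
      have : 0 < Real.sqrt ((p.2 : ℝ) * p.2 / p.1) := Real.sqrt_pos.2 (by positivity)
      positivity
    rcases hadapt with ⟨K, hK⟩ | ⟨K, hK⟩
    · obtain ⟨p, ⟨θ, hθ, E, hE, hPE, hdiam⟩, h0, hr, hp0, hKp⟩ :=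
        (hmain.and (hk₀.and ((hrate K).and (hpos.and hK)))).exists
      have h1 := (ofReal_mul_le_expectedDiam C hE hα₀.le hPE.le hdiam).trans
        ((le_iSup₂_of_le (f := fun θ _ => C.expectedDiam p.1 θ) θ (lowRank_mono h0 hθ) le_rfl).trans
          hKp)
      exact absurd h1 (not_le.2 ((ENNReal.ofReal_lt_ofReal_iff (by positivity)).2 hr))
    · obtain ⟨p, ⟨θ, hθ, E, hE, hPE, hdiam⟩, h0, hr, hp0, hKp⟩ :=
        (hmain.and (hk₀.and ((hrate K).and (hpos.and hK)))).exists
      have h1 := hKp θ (lowRank_mono h0 hθ)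
      have h2 : obsLaw p.1 θ E ≤ ENNReal.ofReal α := by
        refine (measure_mono fun z hz => ?_).trans h1
        refine lt_of_lt_of_le ((ENNReal.ofReal_lt_ofReal_iff hp0).2 (hr.trans_le ?_)) (hdiam z hz)
        exact mul_le_of_le_one_left hp0.le (by linarith)
      exact absurd (ENNReal.toReal_le_of_le_ofReal hα₀.le h2) (not_le.2 hPE)
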